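/- Let $m\ge 1$ be an integer, let $I$ be any index set, and let $\beta^{(i)}$, $i\in I$, be nonzero real numbers; if $m=1$, assume that they are pairwise distinct. Write $V=(v_{m-1},\dots,v_0)\in\mathbb R^m$, $v=v_0$, and similarly $V^i$, $V^{ij}$; superscripts $i,j,k$ denote unit shifts in the directions $i,j,k\in I$ of a lattice, and subscripts denote shifts in a distinguished variable $n\in\mathbb Z$; in particular $V^{ij}=V^{ji}$, and $V_1=(v_m,\dots,v_1)$. Consider the system consisting of the $m$-quad-equations $$(v_m-v^i_m)(v_{m-1}-v^i_{m-1})\cdots(v-v^i)=\beta^{(i)}v_{m-1}\cdots v_1\,v\,v^i\qquad(1)$$ and, for $i\ne j$, of the $m$-component quad-equations $$v^{ij}=\frac{\beta^{(j)}P^{(i)}v^j-\beta^{(i)}P^{(j)}v^i}{\beta^{(j)}P^{(i)}-\beta^{(i)}P^{(j)}},\qquad P^{(i)}=(v_{m-1}-v^i_{m-1})\cdots(v-v^i),\qquad(2)$$ $$\frac{v^{ij}_s-v^j_s}{v^j_{s-1}}+\frac{v^j_s-v^i_s}{v_{s-1}}+\frac{v^i_s-v^{ij}_s}{v^i_{s-1}}=0,\qquad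 s=1,\dots,m-1.\qquad(3)$$ Let $v^i_m=q^{(i)}(V^i,v_m,V)$ and $V^{ij}=R^{(ij)}(V^i,V^j,V)$, with components $r^{(ij)}_{[m-1]},\dots,r^{(ij)}_{[0]}$, be the solutions of (1) with respect to $v^i_m$ and of (2), (3) with respect to $V^{ij}$. Below, "identically" means that both sides are defined for generic real values of the variables (on a set with dense interior) and are equal wherever both are defined. (a) The system is multidimensionally consistent. That is, $R^{(ij)}(V^i,V^j,V)=R^{(ji)}(V^j,V^i,V)$ identically for $i\ne j$, and moreover: (i) for all $i\ne j$, the relations $$r^{(ij)}_{[s]}(V^i_1,V^j_1,V_1)=r^{(ij)}_{[s+1]}(V^i,V^j,V)\quad(0\le s\le m-2),$$ $$r^{(ij)}_{[m-1]}(V^i_1,V^j_1,V_1)=q^{(i)}(V^{ij},v^j_m,V^j)=q^{(j)}(V^{ij},v^i_m,V^i),$$ where $v^i_m=q^{(i)}(V^i,v_m,V)$, $v^j_m=q^{(j)}(V^j,v_m,V)$ and $V^{ij}=R^{(ij)}(V^i,V^j,V)$ are substituted, hold identically in $v_m,V,V^i,V^j$; (ii) for all pairwise distinct $i,j,k$,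 the relations $$R^{(jk)}(V^{ij},V^{ik},V^i)=R^{(ik)}(V^{ij},V^{jk},V^j)=R^{(ij)}(V^{ik},V^{jk},V^k),$$ where $V^{ij}=R^{(ij)}(V^i,V^j,V)$, $V^{ik}=R^{(ik)}(V^i,V^k,V)$ and $V^{jk}=R^{(jk)}(V^j,V^k,V)$ are substituted, hold identically in $V,V^i,V^j,V^k$. (b) The system is consistent with the lattice equation $$\partial_t v=v\Bigl(\frac{v_m}{v}+\frac{v_{m-1}}{v_{-1}}+\cdots+\frac{v}{v_{-m}}\Bigr).\qquad(4)$$ That is, suppose that nowhere vanishing functions $v(n,t)$ and $v^i(n,t)$, $n\in\mathbb Z$ (respectively $v,v^i,v^j,v^{ij}$ with $i\ne j$), all satisfy (4) at a moment $t$ for all $n$, and that at this moment (1) holds for all $n$ (respectively: (1) holds for all $n$ on the pairs $v,v^i$ and $v^j,v^{ij}$ in direction $i$ and on the pairs $v,v^j$ and $v^i,v^{ij}$ in direction $j$, and (2), (3) hold for all $n$ with nonzero denominators). Then the difference of the two sides of (1) (respectively of (2) and of each equation (3)) has zero $t$-derivative at this moment, for every $n$. (c) If a nowhere vanishing $v$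 satisfies (4), then $u=v_m/v$ satisfies the Bogoyavlensky lattice $\partial_t u=u(u_m+\cdots+u_1-u_{-1}-\cdots-u_{-m})$. -/

import Mathlib

noncomputable section

namespace MultiQuad

/-! ## Partially defined maps and generic identities -/

/-- The resolved form of an equation `E x y` with respect to the unknown `y`: the partial map which
is defined at `x` when the equation has exactly one solution `y`, and then returns it. -/
def solve {X Y : Type} (E : X → Y → Prop) : X →. Y :=
  fun x => ⟨∃! y, E x y, fun h => h.choose⟩

/-- `f = g` holds identically: both sides are defined for generic arguments (on a set with dense
interior), and they are equal at every point where both of them are defined. -/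
def IdentEq {X Y : Type} [TopologicalSpace X] (f g : X →. Y) : Prop :=
  Dense (interior (f.Dom ∩ g.Dom)) ∧ ∀ x, ∀ a ∈ f x, ∀ b ∈ g x, a = b

/-! ## Multidimensional consistency -/

/-- The values `V = (v_{m-1}, …, v_0)`; the component with index `s : Fin m` is `v_s`. -/
abbrev Vec (m : ℕ) : Type := Fin m → ℝ

/-- From `V = (v_{m-1}, …, v_0)` and `v_m` to `V_1 = (v_m, …, v_1)`. -/
def shift {m : ℕ} (V : Vec m) (vm : ℝ) : Vec m :=
  fun s => if h : (s : ℕ) + 1 < m then V ⟨s + 1, h⟩ else vm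

/-- Multidimensional consistency of the system
`v^i_m = q^{(i)}(V^i, v_m, V)`, `V^{ij} = R^{(ij)}(V^i, V^j, V)` (`i ≠ j`). -/
structure MultidimConsistent {ι : Type*} {m : ℕ}
    (q : ι → (Vec m × ℝ × Vec m →. ℝ))
    (R : ι → ι → (Vec m × Vec m × Vec m →. Vec m)) : Prop where
  /-- `V^{ij}` and `V^{ji}` denote the same values. -/
  symm : ∀ i j, i ≠ j →
    IdentEq (X := Vec m × Vec m × Vec m)
      (fun (Vi, Vj, V) => R i j (Vi, Vj, V))
      (fun (Vi, Vj, V) => R j i (Vj, Vi, V))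
  /-- `R^{(ij)}(V^i_1, V^j_1, V_1)` has the components `v^{ij}_1, …, v^{ij}_{m-1}` of
  `V^{ij} = R^{(ij)}(V^i, V^j, V)`, followed by `q^{(i)}(V^{ij}, v^j_m, V^j)`. -/
  face_left : ∀ i j, i ≠ j →
    IdentEq (X := ℝ × Vec m × Vec m × Vec m)
      (fun (vm, V, Vi, Vj) => do
        let vim ← q i (Vi, vm, V)
        let vjm ← q j (Vj, vm, V)
        R i j (shift Vi vim, shift Vj vjm, shift V vm))
      (fun (vm, V, Vi, Vj) => do
        let vjm ← q j (Vj, vm, V)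
        let Vij ← R i j (Vi, Vj, V)
        let vijm ← q i (Vij, vjm, Vj)
        return shift Vij vijm)
  /-- The same with `q^{(j)}(V^{ij}, v^i_m, V^i)`. -/
  face_right : ∀ i j, i ≠ j →
    IdentEq (X := ℝ × Vec m × Vec m × Vec m)
      (fun (vm, V, Vi, Vj) => do
        let vim ← q i (Vi, vm, V)
        let vjm ← q j (Vj, vm, V)
        R i j (shift Vi vim, shift Vj vjm, shift V vm))
      (fun (vm, V, Vi, Vj) => do
        let vim ← q i (Vi, vm, V)
        let Vij ← R i j (Vi, Vj, V)
        let vijm ← q j (Vij, vim, Vi)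
        return shift Vij vijm)
  /-- `q^{(i)}(V^{ij}, v^j_m, V^j) = q^{(j)}(V^{ij}, v^i_m, V^i)`. -/
  face_corner : ∀ i j, i ≠ j →
    IdentEq (X := ℝ × Vec m × Vec m × Vec m)
      (fun (vm, V, Vi, Vj) => do
        let vjm ← q j (Vj, vm, V)
        let Vij ← R i j (Vi, Vj, V)
        q i (Vij, vjm, Vj))
      (fun (vm, V, Vi, Vj) => do
        let vim ← q i (Vi, vm, V)
        let Vij ← R i j (Vi, Vj, V)
        q j (Vij, vim, Vi))
  /-- `R^{(jk)}(V^{ij}, V^{ik}, V^i) = R^{(ik)}(V^{ij}, V^{jk}, V^j)`. -/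
  cube_left : ∀ i j k, i ≠ j → j ≠ k → k ≠ i →
    IdentEq (X := Vec m × Vec m × Vec m × Vec m)
      (fun (V, Vi, Vj, Vk) => do
        let Vij ← R i j (Vi, Vj, V)
        let Vik ← R i k (Vi, Vk, V)
        R j k (Vij, Vik, Vi))
      (fun (V, Vi, Vj, Vk) => do
        let Vij ← R i j (Vi, Vj, V)
        let Vjk ← R j k (Vj, Vk, V)
        R i k (Vij, Vjk, Vj))
  /-- `R^{(ik)}(V^{ij}, V^{jk}, V^j) = R^{(ij)}(V^{ik}, V^{jk}, V^k)`. -/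
  cube_right : ∀ i j k, i ≠ j → j ≠ k → k ≠ i →
    IdentEq (X := Vec m × Vec m × Vec m × Vec m)
      (fun (V, Vi, Vj, Vk) => do
        let Vij ← R i j (Vi, Vj, V)
        let Vjk ← R j k (Vj, Vk, V)
        R i k (Vij, Vjk, Vj))
      (fun (V, Vi, Vj, Vk) => do
        let Vik ← R i k (Vi, Vk, V)
        let Vjk ← R j k (Vj, Vk, V)
        R i j (Vik, Vjk, Vk))

/-! ## The equations of the system -/

/-- `P^{(i)} = (v_{m-1} - v^i_{m-1}) ⋯ (v - v^i)`. -/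
def P {m : ℕ} (V Vi : Vec m) : ℝ := ∏ s, (V s - Vi s)

/-- Left minus right side of the `m`-quad-equation
`(v_m - v^i_m) ⋯ (v - v^i) = β v_{m-1} ⋯ v v^i`. -/
def quadRes {m : ℕ} [NeZero m] (β : ℝ) (Vi : Vec m) (vim vm : ℝ) (V : Vec m) : ℝ :=
  (vm - vim) * ∏ s, (V s - Vi s) - β * (∏ s, V s) * Vi 0

/-- Left minus right side of
`v^{ij} = (β^{(j)} P^{(i)} v^j - β^{(i)} P^{(j)} v^i) / (β^{(j)} P^{(i)} - β^{(i)} P^{(j)})`. -/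
def crossResZero {m : ℕ} [NeZero m] (βi βj : ℝ) (Vij Vi Vj V : Vec m) : ℝ :=
  Vij 0 - (βj * P V Vi * Vj 0 - βi * P V Vj * Vi 0) / (βj * P V Vi - βi * P V Vj)

/-- Left side of `(v^{ij}_{s+1} - v^j_{s+1}) / v^j_s + (v^j_{s+1} - v^i_{s+1}) / v_s
+ (v^i_{s+1} - v^{ij}_{s+1}) / v^i_s = 0`. -/
def crossResSucc {m : ℕ} (Vij Vi Vj V : Vec m) (s : ℕ) (hs : s + 1 < m) : ℝ :=
  let p : Fin m := ⟨s, by omega⟩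
  let p' : Fin m := ⟨s + 1, hs⟩
  (Vij p' - Vj p') / Vj p + (Vj p' - Vi p') / V p + (Vi p' - Vij p') / Vi p

/-- The `m`-quad-equation. -/
def QuadEq {m : ℕ} [NeZero m] (β : ℝ) (Vi : Vec m) (vim vm : ℝ) (V : Vec m) : Prop :=
  quadRes β Vi vim vm V = 0

/-- The `m`-component quad-equation: all denominators are different from zero, and all `m` component
equations are fulfilled. -/
structure CrossEq {m : ℕ} [NeZero m] (βi βj : ℝ) (Vij Vi Vj V : Vec m) : Prop where
  denom_zero : βj * P V Vi - βi * P V Vj ≠ 0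
  denom_succ : ∀ (s : ℕ) (hs : s + 1 < m),
    V ⟨s, by omega⟩ ≠ 0 ∧ Vi ⟨s, by omega⟩ ≠ 0 ∧ Vj ⟨s, by omega⟩ ≠ 0
  eq_zero : crossResZero βi βj Vij Vi Vj V = 0
  eq_succ : ∀ (s : ℕ) (hs : s + 1 < m), crossResSucc Vij Vi Vj V s hs = 0

/-- The `m`-quad-equation resolved with respect to `v^i_m`. -/
def quadMap {m : ℕ} [NeZero m] (β : ℝ) : Vec m × ℝ × Vec m →. ℝ :=
  solve fun (Vi, vm, V) vim => QuadEq β Vi vim vm V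

/-- The `m`-component quad-equation resolved with respect to `V^{ij}`. -/
def crossMap {m : ℕ} [NeZero m] (βi βj : ℝ) : Vec m × Vec m × Vec m →. Vec m :=
  solve fun (Vi, Vj, V) Vij => CrossEq βi βj Vij Vi Vj V

/-! ## The lattice equations -/

/-- `v(n + m - 1, t), …, v(n, t)` as a vector. -/
def window (m : ℕ) (v : ℤ → ℝ → ℝ) (n : ℤ) (t : ℝ) : Vec m := fun s => v (n + (s : ℕ)) t

/-- At the moment `t` the nonvanishing `v` satisfies
`∂_t v = v (v_m / v + v_{m-1} / v_{-1} + ⋯ + v / v_{-m})` for all `n`. -/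
def PotentialLatticeAt (m : ℕ) (v : ℤ → ℝ → ℝ) (t : ℝ) : Prop :=
  (∀ n, v n t ≠ 0) ∧
    ∀ n : ℤ, HasDerivAt (v n)
      (v n t * ∑ k ∈ Finset.range (m + 1), v (n + (m : ℤ) - (k : ℤ)) t / v (n - (k : ℤ)) t) t

/-- At the moment `t` the function `u` satisfies
`∂_t u = u (u_m + ⋯ + u_1 - u_{-1} - ⋯ - u_{-m})` for all `n`. -/
def BogoyavlenskyAt (m : ℕ) (u : ℤ → ℝ → ℝ) (t : ℝ) : Prop :=
  ∀ n : ℤ, HasDerivAt (u n)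
    (u n t * (∑ k ∈ Finset.Icc 1 m, u (n + (k : ℤ)) t
      - ∑ k ∈ Finset.Icc 1 m, u (n - (k : ℤ)) t)) t

/-- `v` and its shift `vi` satisfy the `m`-quad-equation for all `n` at the moment `t`. -/
def QuadAt (m : ℕ) [NeZero m] (β : ℝ) (v vi : ℤ → ℝ → ℝ) (t : ℝ) : Prop :=
  ∀ n : ℤ, QuadEq β (window m vi n t) (vi (n + (m : ℤ)) t) (v (n + (m : ℤ)) t) (window m v n t)

/-- `v` and its shifts `vi`, `vj`, `vij` satisfy the `m`-component quad-equation for all `n` at the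
moment `t`. -/
def CrossAt (m : ℕ) [NeZero m] (βi βj : ℝ) (v vi vj vij : ℤ → ℝ → ℝ) (t : ℝ) : Prop :=
  ∀ n : ℤ, CrossEq βi βj (window m vij n t) (window m vi n t) (window m vj n t) (window m v n t)

/-- Consistency of the system with the potential lattice equation: differentiating each equation of
the system with respect to `t` in virtue of the lattice equation gives a relation which holds
identically in virtue of the system itself. -/
structure LatticeConsistent {ι : Type*} (m : ℕ) [NeZero m] (β : ι → ℝ) : Prop where
  quad : ∀ (i : ι) (v vi : ℤ → ℝ → ℝ) (t : ℝ),
    PotentialLatticeAt m v t → PotentialLatticeAt m vi t → QuadAt m (β i) v vi t →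
    ∀ n : ℤ, HasDerivAt
      (fun τ => quadRes (β i) (window m vi n τ) (vi (n + (m : ℤ)) τ) (v (n + (m : ℤ)) τ)
        (window m v n τ)) 0 t
  cross : ∀ (i j : ι), i ≠ j → ∀ (v vi vj vij : ℤ → ℝ → ℝ) (t : ℝ),
    PotentialLatticeAt m v t → PotentialLatticeAt m vi t →
    PotentialLatticeAt m vj t → PotentialLatticeAt m vij t →
    QuadAt m (β i) v vi t → QuadAt m (β j) v vj t →
    QuadAt m (β i) vj vij t → QuadAt m (β j) vi vij t →
    CrossAt m (β i) (β j) v vi vj vij t →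
    ∀ n : ℤ,
      HasDerivAt (fun τ => crossResZero (β i) (β j)
        (window m vij n τ) (window m vi n τ) (window m vj n τ) (window m v n τ)) 0 t ∧
      ∀ (s : ℕ) (hs : s + 1 < m), HasDerivAt (fun τ => crossResSucc
        (window m vij n τ) (window m vi n τ) (window m vj n τ) (window m v n τ) s hs) 0 t

end MultiQuad

end

namespace MultiQuad

/-! For (b), dividing (1) at `n + 1` by (1) at `n` gives the identity `QuadAt.ratio`. It makes the
difference of the logarithmic rates of `v` and `v^i` telescope, so `v - v^i` has an explicit
logarithmic derivative, and the two sides of (1) turn out to have the same one. It also gives `∂_t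
((v_1 - v^i_1) / v) = v^i_1 / v^i_{-m} - v_1 / v_{-m}`, the difference of one vertex function along
an edge. Around a face such differences cancel, which settles (3); modulo (1), equation (2) at `n +
1` is equivalent to the three-term relation between the sites `n` and `n + 1`. Part (c) is a
difference of two rates.

For (a), equations (2) and (3) share the form `v^{ij}_s = (a^j_s v^j_s - a^i_s v^i_s) / (a^j_s -
a^i_s)`, where the weight `a^i` (`wt`) depends only on the edge from `V` to `V^i`. On the face
shifted in `n`, equation (1) makes every weight proportional to `1 / v^i_s - 1 / v_s`, so the
shifted face reproduces the old components and one new component, symmetric in `i`, `j`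
(`FaceGood.shift_mem`, `FaceGood.quadVal_cross_eq`). On a cube, the weight of the edge from `V^i` to
`V^{ij}` is, up to a factor depending on `i` alone, the divided difference `(a^j - a^i) / (y^j -
y^i)` with nodes `pole` (`FaceGood.wt_left_crossVal`). Hence `v^{ijk}` is a quotient of second
divided differences of `a v` and `a`, which is symmetric in `i`, `j`, `k`.

These computations hold on a set with dense interior, and continuity carries the equalities to every
point where both sides are defined. For `m = 1` the weight is `β` times the node, and the
denominator of `v^{ijk}` vanishes identically when the three parameters coincide; distinctness
excludes this. -/

theorem hasDerivAt_prod_of_log {α : Type*} (s : Finset α) (f : α → ℝ → ℝ) (l : α → ℝ) (t : ℝ)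
    (h : ∀ i ∈ s, HasDerivAt (f i) (f i t * l i) t) :
    HasDerivAt (fun τ => ∏ i ∈ s, f i τ) ((∏ i ∈ s, f i t) * ∑ i ∈ s, l i) t := by
  classical
  induction s using Finset.induction_on with
  | empty => simpa using hasDerivAt_const t (1 : ℝ)
  | insert a s ha ih =>
    have h1 := (h a (by simp)).mul (ih fun i hi => h i (by simp [hi]))
    simp only [Finset.prod_insert ha, Finset.sum_insert ha]
    refine (h1.congr_deriv ?_)
    ring

theorem sum_Icc_one_eq_sum_range (f : ℕ → ℝ) (m : ℕ) :
    ∑ k ∈ Finset.Icc 1 m, f k = ∑ k ∈ Finset.range m, f (k + 1) := by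
  induction m with
  | zero => simp
  | succ m ih => rw [Finset.sum_Icc_succ_top (by omega), ih, Finset.sum_range_succ]

/-! ### Rates of the potential lattice and the Bogoyavlensky lattice -/

/-- The logarithmic derivative prescribed by the potential lattice. -/
noncomputable def latticeRate (m : ℕ) (v : ℤ → ℝ → ℝ) (t : ℝ) (n : ℤ) : ℝ :=
  ∑ k ∈ Finset.range (m + 1), v (n - k + m) t / v (n - k) t

theorem PotentialLatticeAt.hasDerivAt {m : ℕ} {v : ℤ → ℝ → ℝ} {t : ℝ}
    (h : PotentialLatticeAt m v t) (n : ℤ) :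
    HasDerivAt (v n) (v n t * latticeRate m v t n) t := by
  refine (h.2 n).congr_deriv ?_
  unfold latticeRate
  congr 1
  refine Finset.sum_congr rfl fun k _ => ?_
  rw [show n + (m : ℤ) - k = n - k + m by ring]

/-- The rates at `n + m` and at `n` are the sums of `u` over the windows `n, …, n + m` and `n - m,
…, n`. The logarithmic derivative of `u` is their difference, in which the common term `u n`
cancels. -/
theorem PotentialLatticeAt.bogoyavlenskyAt {m : ℕ} {v : ℤ → ℝ → ℝ} {t : ℝ}
    (h : PotentialLatticeAt m v t) :
    BogoyavlenskyAt m (fun n τ => v (n + (m : ℤ)) τ / v n τ) t := by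
  intro n
  have h0 := h.1 n
  refine ((h.hasDerivAt (n + m)).div (h.hasDerivAt n) h0).congr_deriv ?_
  have e1 : latticeRate m v t (n + m) =
      ∑ k ∈ Finset.Icc 1 m, v (n + (k : ℤ) + m) t / v (n + (k : ℤ)) t + v (n + m) t / v n t := by
    rw [sum_Icc_one_eq_sum_range, latticeRate, ← Finset.sum_range_reflect, Finset.sum_range_succ']
    congr 1
    · refine Finset.sum_congr rfl fun k hk => ?_
      have hk' := Finset.mem_range.1 hk
      rw [show n + (m : ℤ) - ((m + 1 - 1 - (k + 1) : ℕ) : ℤ) = n + ((k + 1 : ℕ) : ℤ) by omega]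
    · simp
  have e2 : latticeRate m v t n =
      ∑ k ∈ Finset.Icc 1 m, v (n - (k : ℤ) + m) t / v (n - (k : ℤ)) t + v (n + m) t / v n t := by
    rw [sum_Icc_one_eq_sum_range, latticeRate, Finset.sum_range_succ']
    simp
  rw [e1, e2]
  field_simp
  ring

theorem crossResSucc_window {m : ℕ} (v vi vj vij : ℤ → ℝ → ℝ) (n : ℤ) (s : ℕ) (hs : s + 1 < m) (τ : ℝ) :
    crossResSucc (window m vij n τ) (window m vi n τ) (window m vj n τ) (window m v n τ) s hs =
      (vij (n + s + 1) τ - vj (n + s + 1) τ) / vj (n + s) τ +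
      (vj (n + s + 1) τ - vi (n + s + 1) τ) / v (n + s) τ +
      (vi (n + s + 1) τ - vij (n + s + 1) τ) / vi (n + s) τ := by
  simp [crossResSucc, window, add_assoc]

theorem P_window {m : ℕ} (v vi : ℤ → ℝ → ℝ) (n : ℤ) (τ : ℝ) : P (window m v n τ) (window m vi n τ) =
    ∏ s ∈ Finset.range m, (v (n + (s : ℕ)) τ - vi (n + (s : ℕ)) τ) := by
  unfold P window
  rw [Fin.prod_univ_eq_prod_range (fun s : ℕ => v (n + (s : ℕ)) τ - vi (n + (s : ℕ)) τ) m]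

/-! ### Evolution of the `m`-quad-equation -/

section QuadLattice

variable {m : ℕ} [NeZero m] {β : ℝ} {v u : ℤ → ℝ → ℝ} {t : ℝ}

theorem quadRes_window (β : ℝ) (v u : ℤ → ℝ → ℝ) (n : ℤ) (t : ℝ) :
    quadRes β (window m u n t) (u (n + (m : ℤ)) t) (v (n + (m : ℤ)) t) (window m v n t) =
      ∏ s ∈ Finset.range (m + 1), (v (n + (s : ℕ)) t - u (n + (s : ℕ)) t) -
        β * (∏ s ∈ Finset.range m, v (n + (s : ℕ)) t) * u n t := by
  unfold quadRes window
  rw [Fin.prod_univ_eq_prod_range (fun s : ℕ => v (n + (s : ℕ)) t - u (n + (s : ℕ)) t) m,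
    Fin.prod_univ_eq_prod_range (fun s : ℕ => v (n + (s : ℕ)) t) m, Finset.prod_range_succ]
  simp [mul_comm]

theorem QuadAt.prod_eq (h : QuadAt m β v u t) (n : ℤ) :
    ∏ s ∈ Finset.range (m + 1), (v (n + (s : ℕ)) t - u (n + (s : ℕ)) t) =
      β * (∏ s ∈ Finset.range m, v (n + (s : ℕ)) t) * u n t := by
  have := h n
  rw [QuadEq, quadRes_window] at this
  linarith

theorem QuadAt.sub_ne_zero (h : QuadAt m β v u t) (hβ : β ≠ 0) (hv : ∀ n, v n t ≠ 0)
    (hu : ∀ n, u n t ≠ 0) (n : ℤ) : v n t - u n t ≠ 0 := by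
  have h1 : ∏ s ∈ Finset.range (m + 1), (v (n + (s : ℕ)) t - u (n + (s : ℕ)) t) ≠ 0 := by
    rw [h.prod_eq]
    exact mul_ne_zero (mul_ne_zero hβ (Finset.prod_ne_zero_iff.2 fun _ _ => hv _)) (hu _)
  simpa using Finset.prod_ne_zero_iff.1 h1 0 (by simp)

/-- The quotient of the equations at `n + 1` and `n`: the differences at `n + 1, …, n + m` are
common to both and nonzero. -/
theorem QuadAt.ratio (h : QuadAt m β v u t) (hβ : β ≠ 0) (hv : ∀ n, v n t ≠ 0)
    (hu : ∀ n, u n t ≠ 0) (n : ℤ) :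
    (v (n + 1 + m) t - u (n + 1 + m) t) * v n t * u n t =
      (v n t - u n t) * v (n + m) t * u (n + 1) t := by
  have e (k : ℕ) : n + ((k + 1 : ℕ) : ℤ) = n + 1 + k := by push_cast; ring
  have h0 := h.prod_eq n
  have h1 := h.prod_eq (n + 1)
  have h2 : (∏ s ∈ Finset.range m, v (n + (s : ℕ)) t) * v (n + m) t =
      (∏ s ∈ Finset.range m, v (n + 1 + (s : ℕ)) t) * v n t := by
    rw [← Finset.prod_range_succ (fun s : ℕ => v (n + (s : ℕ)) t), Finset.prod_range_succ']
    simp only [e, Nat.cast_zero, add_zero]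
  rw [Finset.prod_range_succ'] at h0
  rw [Finset.prod_range_succ] at h1
  simp only [e, Nat.cast_zero, add_zero] at h0
  have hA : ∏ s ∈ Finset.range m, (v (n + 1 + (s : ℕ)) t - u (n + 1 + (s : ℕ)) t) ≠ 0 :=
    Finset.prod_ne_zero_iff.2 fun _ _ => h.sub_ne_zero hβ hv hu _
  refine mul_left_cancel₀ hA ?_
  linear_combination (v n t * u n t) * h1 - v (n + m) t * u (n + 1) t * h0 -
    β * u n t * u (n + 1) t * h2

/-- By `QuadAt.ratio` each summand of the difference of rates is a difference of consecutive values
of one function, so the sum telescopes. -/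
theorem QuadAt.rate_sub (h : QuadAt m β v u t) (hβ : β ≠ 0) (hv : ∀ n, v n t ≠ 0)
    (hu : ∀ n, u n t ≠ 0) (n : ℤ) :
    latticeRate m v t n - latticeRate m u t n =
      (v n t - u n t) / u (n - m) t - (v (n + 1 + m) t - u (n + 1 + m) t) / u (n + 1) t := by
  have key (j : ℤ) : v (j + m) t / v j t - u (j + m) t / u j t =
      (v (j + m) t - u (j + m) t) / u j t -
        (v (j + 1 + m) t - u (j + 1 + m) t) / u (j + 1) t := by
    have h1 := hv j
    have h2 := hu j
    have h3 := hu (j + 1)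
    have h4 := h.ratio hβ hv hu j
    field_simp
    linear_combination h4
  have tele (M : ℕ) : ∑ k ∈ Finset.range M,
      (v (n - k + m) t / v (n - k) t - u (n - k + m) t / u (n - k) t) =
      (v (n + 1 - M + m) t - u (n + 1 - M + m) t) / u (n + 1 - M) t -
        (v (n + 1 + m) t - u (n + 1 + m) t) / u (n + 1) t := by
    induction M with
    | zero => simp
    | succ M ih =>
      rw [Finset.sum_range_succ, ih, key, show n - (M : ℤ) + 1 = n + 1 - M by ring,
        show n + 1 - ((M + 1 : ℕ) : ℤ) = n - M by push_cast; ring]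
      ring
  rw [latticeRate, latticeRate, ← Finset.sum_sub_distrib, tele,
    show n + 1 - ((m + 1 : ℕ) : ℤ) = n - m by push_cast; ring, sub_add_cancel]

/-- The logarithmic derivative of `v - u` for neighbouring solutions `v`, `u`. -/
theorem QuadAt.hasDerivAt_sub (h : QuadAt m β v u t) (hβ : β ≠ 0) (hv : PotentialLatticeAt m v t)
    (hu : PotentialLatticeAt m u t) (n : ℤ) :
    HasDerivAt (fun τ => v n τ - u n τ) ((v n t - u n t) *
      (∑ k ∈ Finset.range m, v (n - 1 - k + m) t / v (n - 1 - k) t + u n t / u (n - m) t)) t := by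
  refine ((hv.hasDerivAt n).sub (hu.hasDerivAt n)).congr_deriv ?_
  have h1 := h.rate_sub hβ hv.1 hu.1 n
  have h2 := h.ratio hβ hv.1 hu.1 n
  have h3 : latticeRate m v t n =
      ∑ k ∈ Finset.range m, v (n - 1 - k + m) t / v (n - 1 - k) t + v (n + m) t / v n t := by
    rw [latticeRate, Finset.sum_range_succ']
    simp [sub_sub, add_comm]
  rw [show latticeRate m u t n = latticeRate m v t n -
    (latticeRate m v t n - latticeRate m u t n) by ring, h1, h3]
  have hv0 := hv.1 n
  have hu0 := hu.1 (n - m)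
  have hu1 := hu.1 (n + 1)
  field_simp
  linear_combination -u (n - m) t * h2

/-- Both sides of the equation have the same logarithmic derivative, so the derivative of the
residual is that rate times the residual itself. -/
theorem QuadAt.hasDerivAt_quadRes (h : QuadAt m β v u t) (hβ : β ≠ 0)
    (hv : PotentialLatticeAt m v t) (hu : PotentialLatticeAt m u t) (n : ℤ) :
    HasDerivAt (fun τ => quadRes β (window m u n τ) (u (n + (m : ℤ)) τ) (v (n + (m : ℤ)) τ)
        (window m v n τ)) 0 t := by
  simp only [quadRes_window]
  have h1 := hasDerivAt_prod_of_log (Finset.range (m + 1))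
    (fun s τ => v (n + (s : ℕ)) τ - u (n + (s : ℕ)) τ) _ t
    fun s _ => h.hasDerivAt_sub hβ hv hu (n + (s : ℕ))
  have h2 := hasDerivAt_prod_of_log (Finset.range m) (fun s τ => v (n + (s : ℕ)) τ) _ t
    fun s _ => hv.hasDerivAt (n + (s : ℕ))
  refine (h1.sub ((h2.const_mul β).mul (hu.hasDerivAt n))).congr_deriv ?_
  have e1 : ∑ s ∈ Finset.range (m + 1), u (n + (s : ℕ)) t / u (n + (s : ℕ) - m) t =
      latticeRate m u t n := by
    rw [latticeRate, ← Finset.sum_range_reflect]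
    refine Finset.sum_congr rfl fun k hk => ?_
    have hk' := Finset.mem_range.1 hk
    rw [show n + ((m + 1 - 1 - k : ℕ) : ℤ) = n - k + m by omega, add_sub_cancel_right]
  -- The summand depends only on `s - 1 - k`; the substitution `(s, k) ↦ (m - 1 - k, m - s)` turns
  -- the double sum into a sum of rates.
  have e2 : ∑ s ∈ Finset.range (m + 1), ∑ k ∈ Finset.range m,
      v (n + (s : ℕ) - 1 - k + m) t / v (n + (s : ℕ) - 1 - k) t =
      ∑ s ∈ Finset.range m, latticeRate m v t (n + (s : ℕ)) := by
    rw [Finset.sum_comm, ← Finset.sum_range_reflect]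
    refine Finset.sum_congr rfl fun s hs => ?_
    rw [latticeRate, ← Finset.sum_range_reflect]
    refine Finset.sum_congr rfl fun k hk => ?_
    have hk' := Finset.mem_range.1 hk
    have hs' := Finset.mem_range.1 hs
    rw [show n + ((m + 1 - 1 - k : ℕ) : ℤ) - 1 - ((m - 1 - s : ℕ) : ℤ) = n + s - k by omega]
  rw [Finset.sum_add_distrib, e1, e2]
  linear_combination (∑ s ∈ Finset.range m, latticeRate m v t (n + (s : ℕ)) +
    latticeRate m u t n) * h.prod_eq n

/-- The derivative is the increment along the edge from `v` to `u` of the vertex function `w ↦ w (n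
+ 1) / w (n - m)`; this makes sums around a face cancel. -/
theorem QuadAt.hasDerivAt_sub_div (h : QuadAt m β v u t) (hβ : β ≠ 0)
    (hv : PotentialLatticeAt m v t) (hu : PotentialLatticeAt m u t) (n : ℤ) :
    HasDerivAt (fun τ => (v (n + 1) τ - u (n + 1) τ) / v n τ)
      (u (n + 1) t / u (n - m) t - v (n + 1) t / v (n - m) t) t := by
  refine ((h.hasDerivAt_sub hβ hv hu (n + 1)).div (hv.hasDerivAt n) (hv.1 n)).congr_deriv ?_
  have h1 := h.ratio hβ hv.1 hu.1 (n - m)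
  rw [show n - (m : ℤ) + 1 + m = n + 1 by ring, sub_add_cancel] at h1
  rw [latticeRate, Finset.sum_range_succ, add_sub_cancel_right, sub_add_cancel,
    show n + 1 - (m : ℤ) = n - m + 1 by ring]
  have a1 := hv.1 n
  have a2 := hv.1 (n - m)
  have a3 := hu.1 (n - m)
  have a4 := hu.1 (n - m + 1)
  generalize ∑ k ∈ Finset.range m, v (n - k + m) t / v (n - k) t = S
  field_simp
  linear_combination u (n + 1) t * h1

end QuadLattice

/-! ### Evolution of the `m`-component quad-equation -/

section CrossLattice

variable {m : ℕ} [NeZero m] {βi βj : ℝ} {v vi vj vij : ℤ → ℝ → ℝ} {t : ℝ}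

/-- The three-term expression is the signed sum of the edge functions of `QuadAt.hasDerivAt_sub_div`
over the four edges of the face. Only the edge equations enter, not the vanishing of the expression.
-/
theorem hasDerivAt_threeTerm (hi : βi ≠ 0) (hj : βj ≠ 0) (hv : PotentialLatticeAt m v t)
    (hvi : PotentialLatticeAt m vi t) (hvj : PotentialLatticeAt m vj t)
    (hvij : PotentialLatticeAt m vij t) (h1 : QuadAt m βi v vi t) (h2 : QuadAt m βj v vj t)
    (h3 : QuadAt m βi vj vij t) (h4 : QuadAt m βj vi vij t) (n : ℤ) :
    HasDerivAt (fun τ => (vij (n + 1) τ - vj (n + 1) τ) / vj n τ +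
      (vj (n + 1) τ - vi (n + 1) τ) / v n τ + (vi (n + 1) τ - vij (n + 1) τ) / vi n τ) 0 t := by
  have := (((h1.hasDerivAt_sub_div hi hv hvi n).sub (h2.hasDerivAt_sub_div hj hv hvj n)).sub
    (h3.hasDerivAt_sub_div hi hvj hvij n)).add (h4.hasDerivAt_sub_div hj hvi hvij n)
  refine (this.congr_deriv (by ring)).congr_of_eventuallyEq (Filter.Eventually.of_forall ?_)
  intro τ
  simp only [Pi.add_apply, Pi.sub_apply]
  ring

theorem quadRes_window_eq_mul_P (β : ℝ) (v u : ℤ → ℝ → ℝ) (n : ℤ) (t : ℝ) :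
    quadRes β (window m u n t) (u (n + (m : ℤ)) t) (v (n + (m : ℤ)) t) (window m v n t) =
      (v n t - u n t) * P (window m v (n + 1) t) (window m u (n + 1) t) -
        β * (∏ s ∈ Finset.range m, v (n + (s : ℕ)) t) * u n t := by
  have e (k : ℕ) : n + ((k + 1 : ℕ) : ℤ) = n + 1 + k := by push_cast; ring
  rw [quadRes_window, P_window, Finset.prod_range_succ', mul_comm (v n t - u n t)]
  simp only [e, Nat.cast_zero, add_zero]

/-- A product whose first factor vanishes together with its derivative. -/
theorem hasDerivAt_zero_mul {f g : ℝ → ℝ} {t : ℝ} (hf : HasDerivAt f 0 t) (h0 : f t = 0)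
    (hg : DifferentiableAt ℝ g t) : HasDerivAt (fun τ => f τ * g τ) 0 t :=
  (hf.mul hg.hasDerivAt).congr_deriv (by simp [h0])

/-- Up to a nonvanishing factor, the residual `c` is a combination of the residuals of (1) in both
directions and of the three-term expression. Each of these vanishes together with its derivative,
hence so does the derivative of `c`. -/
theorem hasDerivAt_crossResZero (hi : βi ≠ 0) (hj : βj ≠ 0) (hv : PotentialLatticeAt m v t)
    (hvi : PotentialLatticeAt m vi t) (hvj : PotentialLatticeAt m vj t)
    (hvij : PotentialLatticeAt m vij t) (h1 : QuadAt m βi v vi t) (h2 : QuadAt m βj v vj t)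
    (h3 : QuadAt m βi vj vij t) (h4 : QuadAt m βj vi vij t)
    (hc : CrossAt m βi βj v vi vj vij t) (n : ℤ) :
    HasDerivAt (fun τ => crossResZero βi βj (window m vij (n + 1) τ) (window m vi (n + 1) τ)
      (window m vj (n + 1) τ) (window m v (n + 1) τ)) 0 t := by
  have dv (k : ℤ) := (hv.hasDerivAt k).differentiableAt
  have dvi (k : ℤ) := (hvi.hasDerivAt k).differentiableAt
  have dvj (k : ℤ) := (hvj.hasDerivAt k).differentiableAt
  have dvij (k : ℤ) := (hvij.hasDerivAt k).differentiableAt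
  set Pi : ℝ → ℝ := fun τ => P (window m v (n + 1) τ) (window m vi (n + 1) τ) with hPi
  set Pj : ℝ → ℝ := fun τ => P (window m v (n + 1) τ) (window m vj (n + 1) τ) with hPj
  set Q : ℝ → ℝ := fun τ => ∏ s ∈ Finset.range m, v (n + (s : ℕ)) τ with hQ
  have dPi : DifferentiableAt ℝ Pi t := by
    simp only [hPi, P_window]
    exact DifferentiableAt.fun_finsetProd fun i _ => (dv _).sub (dvi _)
  have dPj : DifferentiableAt ℝ Pj t := by
    simp only [hPj, P_window]
    exact DifferentiableAt.fun_finsetProd fun i _ => (dv _).sub (dvj _)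
  have dQ : DifferentiableAt ℝ Q t := DifferentiableAt.fun_finsetProd fun i _ => dv _
  have hd : βj * Pi t - βi * Pj t ≠ 0 := (hc (n + 1)).denom_zero
  set c : ℝ → ℝ := fun τ => vij (n + 1) τ - (βj * Pi τ * vj (n + 1) τ - βi * Pj τ * vi (n + 1) τ) /
    (βj * Pi τ - βi * Pj τ) with hcdef
  have hcc : (fun τ => crossResZero βi βj (window m vij (n + 1) τ) (window m vi (n + 1) τ)
      (window m vj (n + 1) τ) (window m v (n + 1) τ)) = c := by
    funext τ
    simp [crossResZero, window, hcdef, hPi, hPj]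
  have hc0 : c t = 0 := by
    rw [← hcc]; exact (hc (n + 1)).eq_zero
  rw [hcc]
  have dc : DifferentiableAt ℝ c t :=
    (dvij _).sub (((((dPi.const_mul _).mul (dvj _))).sub ((dPj.const_mul _).mul (dvi _))).div
      ((dPi.const_mul _).sub (dPj.const_mul _)) hd)
  set qi : ℝ → ℝ := fun τ => (v n τ - vi n τ) * Pi τ - βi * Q τ * vi n τ with hqi
  set qj : ℝ → ℝ := fun τ => (v n τ - vj n τ) * Pj τ - βj * Q τ * vj n τ with hqj
  set F : ℝ → ℝ := fun τ => (vij (n + 1) τ - vj (n + 1) τ) / vj n τ +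
      (vj (n + 1) τ - vi (n + 1) τ) / v n τ + (vi (n + 1) τ - vij (n + 1) τ) / vi n τ with hF
  have qi' : HasDerivAt qi 0 t := by
    have := h1.hasDerivAt_quadRes hi hv hvi n
    simpa only [quadRes_window_eq_mul_P] using this
  have qj' : HasDerivAt qj 0 t := by
    have := h2.hasDerivAt_quadRes hj hv hvj n
    simpa only [quadRes_window_eq_mul_P] using this
  have qi0 : qi t = 0 := by
    have := h1 n
    rwa [QuadEq, quadRes_window_eq_mul_P] at this
  have qj0 : qj t = 0 := by
    have := h2 n
    rwa [QuadEq, quadRes_window_eq_mul_P] at this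
  have F' : HasDerivAt F 0 t := hasDerivAt_threeTerm hi hj hv hvi hvj hvij h1 h2 h3 h4 n
  have key : (fun τ => c τ * ((βj * Pi τ - βi * Pj τ) * (v n τ - vi n τ) * (v n τ - vj n τ)))
      =ᶠ[nhds t] fun τ => qi τ * (βj * (v n τ - vj n τ) * (vij (n + 1) τ - vj (n + 1) τ)) -
        qj τ * (βi * (v n τ - vi n τ) * (vij (n + 1) τ - vi (n + 1) τ)) +
        F τ * (βi * βj * Q τ * v n τ * vi n τ * vj n τ) := by
    filter_upwards [(dv n).continuousAt.eventually_ne (hv.1 n),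
      (dvi n).continuousAt.eventually_ne (hvi.1 n), (dvj n).continuousAt.eventually_ne (hvj.1 n),
      ((dPi.const_mul βj).sub (dPj.const_mul βi)).continuousAt.eventually_ne hd]
      with τ a1 a2 a3 a4
    change βj * Pi τ - βi * Pj τ ≠ 0 at a4
    simp only [hcdef, hqi, hqj, hF]
    field_simp
    ring
  have hx : (v n t - vi n t) ≠ 0 := h1.sub_ne_zero hi hv.1 hvi.1 n
  have hy : (v n t - vj n t) ≠ 0 := h2.sub_ne_zero hj hv.1 hvj.1 n
  have hQ0 : Q t ≠ 0 := Finset.prod_ne_zero_iff.2 fun _ _ => hv.1 _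
  -- This is read off from `key` and the vanishing of `c`, which also covers `m = 1`, where the
  -- system contains no equation (3).
  have F0 : F t = 0 := by
    have := key.self_of_nhds
    simp only [hc0, qi0, qj0, zero_mul, sub_zero, zero_add] at this
    have hne : βi * βj * Q t * v n t * vi n t * vj n t ≠ 0 := by
      have := hv.1 n
      have := hvi.1 n
      have := hvj.1 n
      positivity
    exact (mul_eq_zero.1 this.symm).resolve_right hne
  have R' := (((hasDerivAt_zero_mul qi' qi0 (g := fun τ => βj * (v n τ - vj n τ) *
      (vij (n + 1) τ - vj (n + 1) τ)) ((((dv n).sub (dvj n)).const_mul _).mul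
        ((dvij _).sub (dvj _)))).sub
    (hasDerivAt_zero_mul qj' qj0 (g := fun τ => βi * (v n τ - vi n τ) *
      (vij (n + 1) τ - vi (n + 1) τ)) ((((dv n).sub (dvi n)).const_mul _).mul
        ((dvij _).sub (dvi _))))).add
    (hasDerivAt_zero_mul F' F0 (g := fun τ => βi * βj * Q τ * v n τ * vi n τ * vj n τ)
      ((((dQ.const_mul _).mul (dv n)).mul (dvi n)).mul (dvj n)))).congr_of_eventuallyEq key
  have dw : DifferentiableAt ℝ
      (fun τ => (βj * Pi τ - βi * Pj τ) * (v n τ - vi n τ) * (v n τ - vj n τ)) t :=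
    (((dPi.const_mul _).sub (dPj.const_mul _)).mul ((dv n).sub (dvi n))).mul ((dv n).sub (dvj n))
  have h := R'.unique (dc.hasDerivAt.mul dw.hasDerivAt)
  simp only [hc0, zero_mul, add_zero, sub_zero] at h
  have h0 : deriv c t = 0 :=
    (mul_eq_zero.1 h.symm).resolve_right (mul_ne_zero (mul_ne_zero hd hx) hy)
  rw [← h0]
  exact dc.hasDerivAt

end CrossLattice

theorem latticeConsistent {ι : Type*} (m : ℕ) [NeZero m] (β : ι → ℝ) (hβ : ∀ i, β i ≠ 0) :
    LatticeConsistent m β where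
  quad i _ _ _ hv hvi h := h.hasDerivAt_quadRes (hβ i) hv hvi
  cross i j _ v vi vj vij t hv hvi hvj hvij h1 h2 h3 h4 hc n := by
    refine ⟨?_, fun s hs => ?_⟩
    · simpa using hasDerivAt_crossResZero (hβ i) (hβ j) hv hvi hvj hvij h1 h2 h3 h4 hc (n - 1)
    · simp only [crossResSucc_window]
      exact hasDerivAt_threeTerm (hβ i) (hβ j) hv hvi hvj hvij h1 h2 h3 h4 (n + s)

open Filter Topology

/-! ### Generic identities -/

section Generic

/-- The filter of the sets with dense interior. -/
def denseInterior (X : Type*) [TopologicalSpace X] : Filter X where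
  sets := {S | Dense (interior S)}
  univ_sets := by simp
  sets_of_superset h hst := h.mono (interior_mono hst)
  inter_sets {S T} hS hT := by
    change Dense (interior (S ∩ T))
    rw [interior_inter]
    exact hS.inter_of_isOpen_left hT isOpen_interior

theorem mem_denseInterior {X : Type*} [TopologicalSpace X] {S : Set X} :
    S ∈ denseInterior X ↔ Dense (interior S) := Iff.rfl

theorem tendsto_denseInterior {X Y : Type*} [TopologicalSpace X] [TopologicalSpace Y] {f : X → Y}
    (hc : Continuous f) (ho : IsOpenMap f) :
    Tendsto f (denseInterior X) (denseInterior Y) := by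
  intro S hS
  exact (Dense.preimage hS ho).mono (preimage_interior_subset_interior_preimage hc)

/-- `F` is a total function which extends `f` and is continuous at the points where `f` is
defined. -/
def ExtendedBy {X Y : Type} [TopologicalSpace X] [TopologicalSpace Y] (f : X →. Y) (F : X → Y) :
    Prop :=
  ∀ x, ∀ a ∈ f x, ContinuousAt F x ∧ F x = a

/-- At a point where both maps are defined but the common value is not yet known, the continuous
extensions are limits of their values along a dense set on which they agree. -/
theorem identEq_of_eventually {X Y : Type} [TopologicalSpace X] [TopologicalSpace Y] [T2Space Y]
    {f g : X →. Y} {F G : X → Y} (hf : ExtendedBy f F) (hg : ExtendedBy g G)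
    (h : ∀ᶠ x in denseInterior X, ∃ a, a ∈ f x ∧ a ∈ g x) : IdentEq f g := by
  refine ⟨?_, fun x a ha b hb => ?_⟩
  · refine mem_denseInterior.1 (mem_of_superset h ?_)
    rintro x ⟨a, ha, hb⟩
    exact ⟨Part.dom_iff_mem.2 ⟨a, ha⟩, Part.dom_iff_mem.2 ⟨a, hb⟩⟩
  · obtain ⟨hF, rfl⟩ := hf x a ha
    obtain ⟨hG, rfl⟩ := hg x b hb
    have hd : Dense {x | ∃ a, a ∈ f x ∧ a ∈ g x} :=
      (mem_denseInterior.1 h).mono interior_subset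
    have : (𝓝[{x | ∃ a, a ∈ f x ∧ a ∈ g x}] x).NeBot :=
      mem_closure_iff_nhdsWithin_neBot.1 (hd x)
    refine tendsto_nhds_unique_of_eventuallyEq (l := 𝓝[{x | ∃ a, a ∈ f x ∧ a ∈ g x}] x)
      (hF.tendsto.mono_left nhdsWithin_le_nhds) (hG.tendsto.mono_left nhdsWithin_le_nhds) ?_
    filter_upwards [self_mem_nhdsWithin] with y hy
    obtain ⟨c, hc, hc'⟩ := hy
    rw [(hf y c hc).2, (hg y c hc').2]

/-- A function which has at most one zero on each line parallel to a coordinate axis is generically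
different from zero. -/
theorem eventually_ne_zero {κ : Type*} {m : ℕ} {p : (κ → Vec m) → Prop}
    (hp : ∀ᶠ W in denseInterior (κ → Vec m), p W) (c : (κ → Vec m) → ℝ)
    (hc : ∀ W, p W → ContinuousAt c W) (q : κ) (s : Fin m)
    (h : ∀ W W', p W → p W' → (∀ r, r ≠ q → W' r = W r) → (∀ l, l ≠ s → W' q l = W q l) →
      c W = 0 → c W' = 0 → W' q s = W q s) :
    ∀ᶠ W in denseInterior (κ → Vec m), c W ≠ 0 := by
  classical
  refine mem_denseInterior.2 (dense_iff_inter_open.2 fun O hO hne => ?_)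
  obtain ⟨W, hWO, hWp⟩ := (mem_denseInterior.1 hp).inter_open_nonempty O hO hne
  suffices ∃ W₁ ∈ O ∩ interior {W | p W}, c W₁ ≠ 0 by
    obtain ⟨W₁, h₁, h₂⟩ := this
    exact ⟨W₁, h₁.1, mem_interior_iff_mem_nhds.2
      ((hc W₁ (interior_subset (s := {W | p W}) h₁.2)).eventually_ne h₂)⟩
  by_cases hW : c W = 0
  -- From a zero `W` only the coordinate `(q, s)` is moved. By `h` no other point of this line
  -- satisfying `p` is a zero, so a small nonzero displacement suffices.
  · let γ : ℝ → κ → Vec m := fun ε => Function.update W q (Function.update (W q) s (W q s + ε))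
    have hγ : Continuous γ := by fun_prop
    have h0 : γ 0 = W := by simp [γ]
    have hev : ∀ᶠ ε in 𝓝[≠] (0 : ℝ), γ ε ∈ O ∩ interior {W | p W} :=
      (hγ.continuousAt.eventually_mem ((hO.inter isOpen_interior).mem_nhds
        (by rw [h0]; exact ⟨hWO, hWp⟩))).filter_mono nhdsWithin_le_nhds
    obtain ⟨ε, hε, hε0⟩ := (hev.and self_mem_nhdsWithin).exists
    refine ⟨γ ε, hε, fun hcε => hε0 ?_⟩
    have := h W (γ ε) (interior_subset (s := {W | p W}) hWp)
      (interior_subset (s := {W | p W}) hε.2) (fun r hr => by simp [γ, hr])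
      (fun l hl => by simp [γ, hl]) hW hcε
    simpa [γ] using this
  · exact ⟨W, ⟨hWO, hWp⟩, hW⟩

end Generic

/-! ### Explicit solutions of the equations -/

section Solve

theorem mem_solve {X Y : Type} {E : X → Y → Prop} {x : X} {a : Y} :
    a ∈ solve E x ↔ E x a ∧ ∀ y, E x y → y = a := by
  constructor
  · rintro ⟨h, rfl⟩
    exact ⟨h.choose_spec.1, h.choose_spec.2⟩
  · intro h
    have hu : ∃! y, E x y := ⟨a, h⟩
    exact ⟨hu, h.2 _ hu.choose_spec.1⟩

end Solve

variable {n : ℕ}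

section Formulas

theorem P_eq_zero_mul (V Vi : Vec (n + 1)) :
    P V Vi = (V 0 - Vi 0) * ∏ k : Fin n, (V k.succ - Vi k.succ) :=
  Fin.prod_univ_succ _

theorem P_eq_mul_last (V Vi : Vec (n + 1)) :
    P V Vi = (∏ k : Fin n, (V k.castSucc - Vi k.castSucc)) * (V (Fin.last n) - Vi (Fin.last n)) :=
  Fin.prod_univ_castSucc _

theorem P_ne_zero {V Vi : Vec (n + 1)} : P V Vi ≠ 0 ↔ ∀ s, V s ≠ Vi s := by
  simp [P, Finset.prod_ne_zero_iff, sub_ne_zero]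

@[simp] theorem shift_castSucc (V : Vec (n + 1)) (vm : ℝ) (k : Fin n) :
    shift V vm k.castSucc = V k.succ := by
  simp only [shift, Fin.val_castSucc]
  rw [dif_pos (by omega)]
  rfl

@[simp] theorem shift_last (V : Vec (n + 1)) (vm : ℝ) : shift V vm (Fin.last n) = vm := by
  simp [shift]

theorem continuous_shift {m : ℕ} : Continuous fun p : Vec m × ℝ => shift p.1 p.2 := by
  refine continuous_pi fun s => ?_
  unfold shift
  split_ifs <;> fun_prop

/-- Both sides are the product of all `m + 1` differences, split at the last or at the first factor.
-/
theorem P_shift_mul (V Vi : Vec (n + 1)) (vm vim : ℝ) :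
    P (shift V vm) (shift Vi vim) * (V 0 - Vi 0) = P V Vi * (vm - vim) := by
  rw [P_eq_mul_last (shift V vm), P_eq_zero_mul V]
  simp only [shift_castSucc, shift_last]
  ring

/-- The solution of the `m`-quad-equation. -/
noncomputable def quadVal (β : ℝ) (p : Vec (n + 1) × ℝ × Vec (n + 1)) : ℝ :=
  p.2.1 - β * (∏ s, p.2.2 s) * p.1 0 / P p.2.2 p.1

/-- The equation is linear in the unknown with coefficient `-P V Vi`; if this vanishes, the unknown
drops out and uniqueness fails. -/
theorem mem_quadMap {β : ℝ} {Vi V : Vec (n + 1)} {vm a : ℝ} :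
    a ∈ quadMap β (Vi, vm, V) ↔ P V Vi ≠ 0 ∧ quadVal β (Vi, vm, V) = a := by
  unfold quadMap
  rw [mem_solve]
  simp only [QuadEq, quadRes, quadVal]
  change ((vm - a) * P V Vi - _ = 0 ∧ ∀ y, (vm - y) * P V Vi - _ = 0 → y = a) ↔ _
  constructor
  · rintro ⟨h1, h2⟩
    have hP : P V Vi ≠ 0 := by
      intro hP
      have := h2 (a + 1) (by rw [hP] at h1 ⊢; linarith)
      linarith
    refine ⟨hP, ?_⟩
    field_simp
    linarith
  · rintro ⟨hP, rfl⟩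
    refine ⟨by field_simp; ring, fun y hy => ?_⟩
    field_simp
    linarith

/-- The weight of `V^i` in the equation for `V^{ij}`, without denominators. -/
def pairWt (β : ℝ) (V Vi Vj : Vec (n + 1)) : Vec (n + 1) :=
  Fin.cons (β * P V Vj) fun k : Fin n => (V k.castSucc - Vi k.castSucc) * Vj k.castSucc

/-- The solution of the `m`-component quad-equation. -/
noncomputable def crossVal (βi βj : ℝ) (p : Vec (n + 1) × Vec (n + 1) × Vec (n + 1)) :
    Vec (n + 1) :=
  fun s => (pairWt βj p.2.2 p.2.1 p.1 s * p.2.1 s - pairWt βi p.2.2 p.1 p.2.1 s * p.1 s) /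
    (pairWt βj p.2.2 p.2.1 p.1 s - pairWt βi p.2.2 p.1 p.2.1 s)

theorem crossVal_symm (βi βj : ℝ) (Vi Vj V : Vec (n + 1)) :
    crossVal βi βj (Vi, Vj, V) = crossVal βj βi (Vj, Vi, V) := by
  funext s
  simp only [crossVal]
  rw [← neg_div_neg_eq, neg_sub, neg_sub]

/-- Each component equation is linear in its own unknown, with the difference of the two weights as
coefficient. The first one excludes a zero denominator explicitly; in the others equal weights would
contradict uniqueness. -/
theorem mem_crossMap {βi βj : ℝ} {Vi Vj V a : Vec (n + 1)} :
    a ∈ crossMap βi βj (Vi, Vj, V) ↔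
      ((∀ k : Fin n, V k.castSucc ≠ 0 ∧ Vi k.castSucc ≠ 0 ∧ Vj k.castSucc ≠ 0) ∧
        ∀ s, pairWt βj V Vj Vi s ≠ pairWt βi V Vi Vj s) ∧ crossVal βi βj (Vi, Vj, V) = a := by
  have lin (k : Fin n) (h : V k.castSucc ≠ 0 ∧ Vi k.castSucc ≠ 0 ∧ Vj k.castSucc ≠ 0) (x : ℝ) :
      (x - Vj k.succ) / Vj k.castSucc + (Vj k.succ - Vi k.succ) / V k.castSucc +
        (Vi k.succ - x) / Vi k.castSucc = 0 ↔
      (pairWt βj V Vj Vi k.succ - pairWt βi V Vi Vj k.succ) * x =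
        pairWt βj V Vj Vi k.succ * Vj k.succ - pairWt βi V Vi Vj k.succ * Vi k.succ := by
    obtain ⟨h1, h2, h3⟩ := h
    simp only [pairWt, Fin.cons_succ]
    field_simp
    constructor <;> intro h <;> linarith
  unfold crossMap
  rw [mem_solve]
  constructor
  · rintro ⟨h, huniq⟩
    have hd : ∀ k : Fin n, V k.castSucc ≠ 0 ∧ Vi k.castSucc ≠ 0 ∧ Vj k.castSucc ≠ 0 :=
      fun k => h.denom_succ k (by omega)
    have hs (k : Fin n) := h.eq_succ k (by omega)
    have hw : ∀ s, pairWt βj V Vj Vi s ≠ pairWt βi V Vi Vj s := by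
      intro s
      refine Fin.cases ?_ (fun k => ?_) s
      · simpa [pairWt, sub_ne_zero] using h.denom_zero
      · intro he
        -- With equal weights the component `k.succ` is unconstrained, so raising it by `1` gives
        -- another solution.
        have hne : Function.update a k.succ (a k.succ + 1) = a := by
          refine huniq _ ⟨h.denom_zero, h.denom_succ, ?_, fun l hl => ?_⟩
          · have := h.eq_zero
            simpa [crossResZero, Function.update_of_ne (Fin.succ_ne_zero k).symm] using this
          · by_cases hlk : (⟨l + 1, hl⟩ : Fin (n + 1)) = k.succ
            · have hlk' : l = k := by simpa [Fin.ext_iff] using hlk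
              subst hlk'
              have h1 := (lin k (hd k) _).1 (hs k)
              refine (lin k (hd k) (Function.update a k.succ (a k.succ + 1) k.succ)).2 ?_
              rw [he, sub_self, zero_mul] at h1 ⊢
              exact h1
            · have h1 := h.eq_succ l hl
              simp only [crossResSucc] at h1 ⊢
              rwa [Function.update_of_ne hlk]
        have := congrFun hne k.succ
        simp at this
    refine ⟨⟨hd, hw⟩, ?_⟩
    funext s
    refine Fin.cases ?_ (fun k => ?_) s
    · have := h.eq_zero
      simp only [crossResZero, sub_eq_zero] at this
      simpa [crossVal, pairWt] using this.symm
    · have h1 := (lin k (hd k) (a k.succ)).1 (hs k)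
      simp only [crossVal]
      rw [div_eq_iff (sub_ne_zero.2 (hw _)), ← h1, mul_comm]
  · rintro ⟨⟨hd, hw⟩, rfl⟩
    have hd0 : βj * P V Vi - βi * P V Vj ≠ 0 := by
      simpa [pairWt, sub_ne_zero] using hw 0
    refine ⟨⟨hd0, fun s hs => hd ⟨s, by omega⟩, ?_, fun s hs => ?_⟩, fun y hy => ?_⟩
    · simp [crossResZero, crossVal, pairWt]
    · refine (lin ⟨s, by omega⟩ (hd _) _).2 ?_
      simp only [crossVal]
      exact mul_div_cancel₀ _ (sub_ne_zero.2 (hw _))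
    · funext s
      refine Fin.cases ?_ (fun k => ?_) s
      · have := hy.eq_zero
        simp only [crossResZero, sub_eq_zero] at this
        simpa [crossVal, pairWt] using this
      · have h1 := (lin k (hd k) (y k.succ)).1 (hy.eq_succ k (by omega))
        simp only [crossVal]
        rw [eq_div_iff (sub_ne_zero.2 (hw _)), ← h1, mul_comm]

theorem crossMap_symm (βi βj : ℝ) (Vi Vj V : Vec (n + 1)) :
    crossMap βi βj (Vi, Vj, V) = crossMap βj βi (Vj, Vi, V) := by
  ext a
  rw [mem_crossMap, mem_crossMap, crossVal_symm]
  refine and_congr_left fun _ => and_congr (forall_congr' fun k => ?_) (forall_congr' fun s => ne_comm)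
  tauto

end Formulas

/-! ### Continuity of the explicit solutions -/

section Continuity

variable {X : Type*} [TopologicalSpace X] {A B C : X → Vec (n + 1)} {x : X}

theorem _root_.ContinuousAt.P (hA : ContinuousAt A x) (hB : ContinuousAt B x) :
    ContinuousAt (fun y => MultiQuad.P (A y) (B y)) x := by
  unfold MultiQuad.P
  exact tendsto_finsetProd _ fun s _ => (continuousAt_pi.1 hA s).sub (continuousAt_pi.1 hB s)

theorem _root_.ContinuousAt.pairWt (β : ℝ) (hA : ContinuousAt A x) (hB : ContinuousAt B x)
    (hC : ContinuousAt C x) (s : Fin (n + 1)) :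
    ContinuousAt (fun y => MultiQuad.pairWt β (A y) (B y) (C y) s) x := by
  refine Fin.cases ?_ (fun k => ?_) s
  · simp only [MultiQuad.pairWt, Fin.cons_zero]
    exact continuousAt_const.mul (hA.P hC)
  · simp only [MultiQuad.pairWt, Fin.cons_succ]
    exact ((continuousAt_pi.1 hA _).sub (continuousAt_pi.1 hB _)).mul (continuousAt_pi.1 hC _)

theorem quadMap_extend {β a : ℝ} {f : X → ℝ} (hA : ContinuousAt A x) (hf : ContinuousAt f x)
    (hB : ContinuousAt B x) (h : a ∈ quadMap β (A x, f x, B x)) :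
    ContinuousAt (fun y => quadVal β (A y, f y, B y)) x ∧ quadVal β (A x, f x, B x) = a := by
  rw [mem_quadMap] at h
  refine ⟨?_, h.2⟩
  unfold quadVal
  exact hf.sub (ContinuousAt.div ((continuousAt_const.mul
    (tendsto_finsetProd _ fun s _ => continuousAt_pi.1 hB s)).mul (continuousAt_pi.1 hA 0))
    (hB.P hA) h.1)

theorem crossMap_extend {βi βj : ℝ} {a : Vec (n + 1)} (hA : ContinuousAt A x)
    (hB : ContinuousAt B x) (hC : ContinuousAt C x) (h : a ∈ crossMap βi βj (A x, B x, C x)) :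
    ContinuousAt (fun y => crossVal βi βj (A y, B y, C y)) x ∧
      crossVal βi βj (A x, B x, C x) = a := by
  rw [mem_crossMap] at h
  refine ⟨continuousAt_pi.2 fun s => ?_, h.2⟩
  have h1 := hC.pairWt βj hB hA s
  have h2 := hC.pairWt βi hA hB s
  unfold crossVal
  refine ContinuousAt.div ?_ (h1.sub h2) (sub_ne_zero.2 (h.1.2 s))
  exact (h1.mul (continuousAt_pi.1 hB s)).sub (h2.mul (continuousAt_pi.1 hA s))

theorem shift_continuousAt {f : X → ℝ} (hA : ContinuousAt A x) (hf : ContinuousAt f x) :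
    ContinuousAt (fun y => shift (A y) (f y)) x :=
  ContinuousAt.comp (g := fun p : Vec (n + 1) × ℝ => shift p.1 p.2) (f := fun y => (A y, f y))
    continuous_shift.continuousAt (hA.prodMk hf)

end Continuity

/-! ### Edge weights and consistency on a face -/

/-- The weight of `V^i` in the equation for `V^{ij}`. -/
noncomputable def wt (β : ℝ) (V Vi : Vec (n + 1)) : Vec (n + 1) :=
  Fin.cons (β / P V Vi) fun k : Fin n => (Vi k.castSucc)⁻¹ - (V k.castSucc)⁻¹

@[simp] theorem wt_zero (β : ℝ) (V Vi : Vec (n + 1)) : wt β V Vi 0 = β / P V Vi := rfl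

@[simp] theorem wt_succ (β : ℝ) (V Vi : Vec (n + 1)) (k : Fin n) :
    wt β V Vi k.succ = (Vi k.castSucc)⁻¹ - (V k.castSucc)⁻¹ := rfl

/-- The weights `pairWt` of the two edges are the weights `wt` times a common nonzero factor, and
the formula for the solution is homogeneous of degree zero in the weights. -/
theorem mem_crossMap_of_wt {βi βj : ℝ} {V Vi Vj : Vec (n + 1)}
    (hV : ∀ k : Fin n, V k.castSucc ≠ 0) (hVi : ∀ k : Fin n, Vi k.castSucc ≠ 0)
    (hVj : ∀ k : Fin n, Vj k.castSucc ≠ 0) (hPi : P V Vi ≠ 0) (hPj : P V Vj ≠ 0)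
    (hw : ∀ s, wt βi V Vi s ≠ wt βj V Vj s) :
    (fun s => (wt βj V Vj s * Vj s - wt βi V Vi s * Vi s) / (wt βj V Vj s - wt βi V Vi s)) ∈
      crossMap βi βj (Vi, Vj, V) := by
  have key (s : Fin (n + 1)) : ∃ c, c ≠ 0 ∧ pairWt βj V Vj Vi s = c * wt βj V Vj s ∧
      pairWt βi V Vi Vj s = c * wt βi V Vi s := by
    refine Fin.cases ?_ (fun k => ?_) s
    · refine ⟨P V Vi * P V Vj, mul_ne_zero hPi hPj, ?_, ?_⟩ <;>
      · simp only [pairWt, Fin.cons_zero, wt_zero]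
        field_simp
    · have h1 := hV k
      have h2 := hVi k
      have h3 := hVj k
      refine ⟨V k.castSucc * Vi k.castSucc * Vj k.castSucc, by positivity, ?_, ?_⟩ <;>
      · simp only [pairWt, Fin.cons_succ, wt_succ]
        field_simp
  refine mem_crossMap.2 ⟨⟨fun k => ⟨hV k, hVi k, hVj k⟩, fun s => ?_⟩, ?_⟩
  · obtain ⟨c, hc, h1, h2⟩ := key s
    rw [h1, h2]
    exact fun h => hw s (mul_left_cancel₀ hc h).symm
  · funext s
    obtain ⟨c, hc, h1, h2⟩ := key s
    simp only [crossVal]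
    rw [h1, h2, mul_assoc, mul_assoc, ← mul_sub, ← mul_sub, mul_div_mul_left _ _ hc]

/-- Nondegenerate initial data for a face in the directions `i`, `j`. -/
structure FaceGood (βi βj : ℝ) (V Vi Vj : Vec (n + 1)) : Prop where
  base_ne : ∀ s, V s ≠ 0
  left_ne : ∀ s, Vi s ≠ 0
  right_ne : ∀ s, Vj s ≠ 0
  base_left : ∀ s, V s ≠ Vi s
  base_right : ∀ s, V s ≠ Vj s
  left_right : ∀ s, Vi s ≠ Vj s
  wt_ne : wt βi V Vi 0 ≠ wt βj V Vj 0

namespace FaceGood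

variable {βi βj : ℝ} {V Vi Vj : Vec (n + 1)}

theorem symm (h : FaceGood βi βj V Vi Vj) : FaceGood βj βi V Vj Vi where
  base_ne := h.base_ne
  left_ne := h.right_ne
  right_ne := h.left_ne
  base_left := h.base_right
  base_right := h.base_left
  left_right s := (h.left_right s).symm
  wt_ne := h.wt_ne.symm

theorem P_left (h : FaceGood βi βj V Vi Vj) : P V Vi ≠ 0 := P_ne_zero.2 h.base_left

theorem P_right (h : FaceGood βi βj V Vi Vj) : P V Vj ≠ 0 := P_ne_zero.2 h.base_right

theorem wt_ne_wt (h : FaceGood βi βj V Vi Vj) (s : Fin (n + 1)) :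
    wt βi V Vi s ≠ wt βj V Vj s := by
  refine Fin.cases h.wt_ne (fun k => ?_) s
  simpa using h.left_right k.castSucc

theorem crossVal_mem (h : FaceGood βi βj V Vi Vj) :
    crossVal βi βj (Vi, Vj, V) ∈ crossMap βi βj (Vi, Vj, V) := by
  have := mem_crossMap_of_wt (fun k => h.base_ne k.castSucc) (fun k => h.left_ne k.castSucc)
    (fun k => h.right_ne k.castSucc) h.P_left h.P_right h.wt_ne_wt
  rwa [(mem_crossMap.1 this).2]

theorem crossVal_apply (h : FaceGood βi βj V Vi Vj) (s : Fin (n + 1)) :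
    crossVal βi βj (Vi, Vj, V) s =
      (wt βj V Vj s * Vj s - wt βi V Vi s * Vi s) / (wt βj V Vj s - wt βi V Vi s) := by
  have := mem_crossMap_of_wt (fun k => h.base_ne k.castSucc) (fun k => h.left_ne k.castSucc)
    (fun k => h.right_ne k.castSucc) h.P_left h.P_right h.wt_ne_wt
  exact congrFun (mem_crossMap.1 this).2 s

theorem left_sub_crossVal (h : FaceGood βi βj V Vi Vj) (s : Fin (n + 1)) :
    Vi s - crossVal βi βj (Vi, Vj, V) s =
      wt βj V Vj s / (wt βj V Vj s - wt βi V Vi s) * (Vi s - Vj s) := by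
  rw [h.crossVal_apply]
  have := sub_ne_zero.2 (h.wt_ne_wt s).symm
  field_simp
  ring

/-- The product `P` on the edge opposite to the edge in the direction `j`. -/
theorem P_left_crossVal (h : FaceGood βi βj V Vi Vj) :
    P Vi (crossVal βi βj (Vi, Vj, V)) = wt βj V Vj 0 / (wt βj V Vj 0 - wt βi V Vi 0) *
      (P V Vj * (Vi (Fin.last n) - Vj (Fin.last n)) / (V (Fin.last n) - Vj (Fin.last n))) *
      ((∏ k : Fin n, Vi k.castSucc) / ∏ k : Fin n, V k.castSucc) := by
  have hs (k : Fin n) : Vi k.succ - crossVal βi βj (Vi, Vj, V) k.succ =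
      (V k.castSucc - Vj k.castSucc) * Vi k.castSucc /
        (V k.castSucc * (Vi k.castSucc - Vj k.castSucc)) * (Vi k.succ - Vj k.succ) := by
    rw [h.left_sub_crossVal]
    simp only [wt_succ]
    have h1 := h.base_ne k.castSucc
    have h2 := h.left_ne k.castSucc
    have h3 := h.right_ne k.castSucc
    have h4 := sub_ne_zero.2 (h.left_right k.castSucc)
    have h5 : (Vj k.castSucc)⁻¹ - (Vi k.castSucc)⁻¹ ≠ 0 :=
      sub_ne_zero.2 (inv_injective.ne (h.left_right k.castSucc).symm)
    congr 1
    have e : (Vj k.castSucc)⁻¹ - (V k.castSucc)⁻¹ - ((Vi k.castSucc)⁻¹ - (V k.castSucc)⁻¹) =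
      (Vi k.castSucc - Vj k.castSucc) / (Vi k.castSucc * Vj k.castSucc) := by
      field_simp
      ring
    rw [e]
    field_simp
  -- The factors `Vi - Vj` at consecutive indices telescope: comparing the two splittings of `P Vi
  -- Vj` leaves only the last difference.
  have hE := (P_eq_zero_mul Vi Vj).symm.trans (P_eq_mul_last Vi Vj)
  rw [P_eq_zero_mul Vi, h.left_sub_crossVal, P_eq_mul_last V Vj]
  simp only [hs]
  rw [Finset.prod_mul_distrib, Finset.prod_div_distrib, Finset.prod_mul_distrib,
    Finset.prod_mul_distrib]
  have h1 : ∏ k : Fin n, V k.castSucc ≠ 0 := Finset.prod_ne_zero_iff.2 fun k _ => h.base_ne _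
  have h2 : ∏ k : Fin n, (Vi k.castSucc - Vj k.castSucc) ≠ 0 :=
    Finset.prod_ne_zero_iff.2 fun k _ => sub_ne_zero.2 (h.left_right _)
  have h3 : V (Fin.last n) - Vj (Fin.last n) ≠ 0 := sub_ne_zero.2 (h.base_right _)
  generalize wt βj V Vj 0 / (wt βj V Vj 0 - wt βi V Vi 0) = T
  generalize ∏ k : Fin n, (Vi k.succ - Vj k.succ) = E at *
  generalize ∏ k : Fin n, (Vi k.castSucc - Vj k.castSucc) = E' at *
  field_simp
  linear_combination T * (∏ k : Fin n, (V k.castSucc - Vj k.castSucc)) *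
    (∏ k : Fin n, Vi k.castSucc) * hE

theorem P_left_crossVal_ne_zero (h : FaceGood βi βj V Vi Vj) (hj : βj ≠ 0) :
    P Vi (crossVal βi βj (Vi, Vj, V)) ≠ 0 := by
  rw [h.P_left_crossVal]
  have h1 : ∏ k : Fin n, V k.castSucc ≠ 0 := Finset.prod_ne_zero_iff.2 fun k _ => h.base_ne _
  have h2 : ∏ k : Fin n, Vi k.castSucc ≠ 0 := Finset.prod_ne_zero_iff.2 fun k _ => h.left_ne _
  refine mul_ne_zero (mul_ne_zero (div_ne_zero (div_ne_zero hj h.P_right)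
    (sub_ne_zero.2 h.wt_ne.symm)) (div_ne_zero (mul_ne_zero h.P_right ?_) ?_)) (div_ne_zero h2 h1)
  · exact sub_ne_zero.2 (h.left_right _)
  · exact sub_ne_zero.2 (h.base_right _)

theorem quadVal_left (h : FaceGood βi βj V Vi Vj) (vm : ℝ) :
    quadVal βi (Vi, vm, V) ∈ quadMap βi (Vi, vm, V) := mem_quadMap.2 ⟨h.P_left, rfl⟩

theorem quadVal_cross (h : FaceGood βi βj V Vi Vj) (hj : βj ≠ 0) (vm : ℝ) :
    quadVal βj (crossVal βi βj (Vi, Vj, V), vm, Vi) ∈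
      quadMap βj (crossVal βi βj (Vi, Vj, V), vm, Vi) :=
  mem_quadMap.2 ⟨h.P_left_crossVal_ne_zero hj, rfl⟩

/-- The new value `v^{ij}_m` satisfies the formula that (3) would give for `s = m`. That formula is
unchanged when `i` and `j` are exchanged, which yields `corner_eq`. -/
theorem quadVal_cross_eq (h : FaceGood βi βj V Vi Vj) (hj : βj ≠ 0) (vm : ℝ) :
    quadVal βj (crossVal βi βj (Vi, Vj, V), quadVal βi (Vi, vm, V), Vi) =
      (((Vj (Fin.last n))⁻¹ - (V (Fin.last n))⁻¹) * quadVal βj (Vj, vm, V) -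
        ((Vi (Fin.last n))⁻¹ - (V (Fin.last n))⁻¹) * quadVal βi (Vi, vm, V)) /
        ((Vj (Fin.last n))⁻¹ - (V (Fin.last n))⁻¹ -
          ((Vi (Fin.last n))⁻¹ - (V (Fin.last n))⁻¹)) := by
  have h1 : ∏ k : Fin n, V k.castSucc ≠ 0 := Finset.prod_ne_zero_iff.2 fun k _ => h.base_ne _
  have h2 : ∏ k : Fin n, Vi k.castSucc ≠ 0 := Finset.prod_ne_zero_iff.2 fun k _ => h.left_ne _
  have h3 := sub_ne_zero.2 (h.left_right (Fin.last n))
  have h4 := sub_ne_zero.2 (h.base_right (Fin.last n))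
  have h5 := h.P_left
  have h6 := h.P_right
  have h7 : wt βj V Vj 0 - wt βi V Vi 0 ≠ 0 := sub_ne_zero.2 h.wt_ne.symm
  have h8 := h.base_ne (Fin.last n)
  have h9 := h.left_ne (Fin.last n)
  have h10 := h.right_ne (Fin.last n)
  have e : (Vj (Fin.last n))⁻¹ - (V (Fin.last n))⁻¹ -
      ((Vi (Fin.last n))⁻¹ - (V (Fin.last n))⁻¹) =
      (Vi (Fin.last n) - Vj (Fin.last n)) / (Vi (Fin.last n) * Vj (Fin.last n)) := by
    field_simp
    ring
  have hjP : wt βj V Vj 0 * P V Vj = βj := div_mul_cancel₀ _ h6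
  have hiP : wt βi V Vi 0 * P V Vi = βi := div_mul_cancel₀ _ h5
  have hQ : βj * (∏ s, Vi s) * crossVal βi βj (Vi, Vj, V) 0 /
      P Vi (crossVal βi βj (Vi, Vj, V)) = (wt βj V Vj 0 * Vj 0 - wt βi V Vi 0 * Vi 0) *
      ((∏ s, V s) / V (Fin.last n)) * Vi (Fin.last n) * (V (Fin.last n) - Vj (Fin.last n)) /
        (Vi (Fin.last n) - Vj (Fin.last n)) := by
    rw [h.P_left_crossVal, h.crossVal_apply, Fin.prod_univ_castSucc, Fin.prod_univ_castSucc V]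
    nth_rewrite 1 [← hjP]
    have h11 : wt βj V Vj 0 ≠ 0 := div_ne_zero hj h6
    field_simp
  have qi : quadVal βi (Vi, vm, V) = vm - wt βi V Vi 0 * Vi 0 * ∏ s, V s := by
    simp only [quadVal, wt_zero]
    ring
  have qj : quadVal βj (Vj, vm, V) = vm - wt βj V Vj 0 * Vj 0 * ∏ s, V s := by
    simp only [quadVal, wt_zero]
    ring
  rw [quadVal]
  simp only
  rw [hQ, qi, qj, e]
  field_simp
  ring

/-- By (1), the product `P` of a shifted edge is `β (∏ V) U_0 / (V_0 - U_0)`. All weights of the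
shifted face are therefore `1 / U_s - 1 / V_s` up to a factor common to both directions. For `s < m
- 1` this is the original weight of index `s + 1`; for the last index `quadVal_cross_eq` applies. -/
theorem shift_mem (h : FaceGood βi βj V Vi Vj) (hi : βi ≠ 0) (hj : βj ≠ 0) (vm : ℝ) :
    shift (crossVal βi βj (Vi, Vj, V))
        (quadVal βj (crossVal βi βj (Vi, Vj, V), quadVal βi (Vi, vm, V), Vi)) ∈
      crossMap βi βj (shift Vi (quadVal βi (Vi, vm, V)), shift Vj (quadVal βj (Vj, vm, V)),
        shift V vm) := by
  have hPV : ∏ s, V s ≠ 0 := Finset.prod_ne_zero_iff.2 fun k _ => h.base_ne _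
  have edge {β : ℝ} {U : Vec (n + 1)} (hβ : β ≠ 0) (hU : ∀ s, U s ≠ 0) (hVU : ∀ s, V s ≠ U s) :
      P (shift V vm) (shift U (quadVal β (U, vm, V))) ≠ 0 ∧
      ∀ s, wt β (shift V vm) (shift U (quadVal β (U, vm, V))) s =
        (Fin.cons (V 0 / ∏ s, V s) (fun _ => 1) : Vec (n + 1)) s * ((U s)⁻¹ - (V s)⁻¹) := by
    have hP : P V U ≠ 0 := P_ne_zero.2 hVU
    have h0 := sub_ne_zero.2 (hVU 0)
    have hU0 := hU 0
    have hV0 := h.base_ne 0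
    have hs : P (shift V vm) (shift U (quadVal β (U, vm, V))) =
        β * (∏ s, V s) * U 0 / (V 0 - U 0) := by
      rw [eq_div_iff h0, P_shift_mul]
      simp only [quadVal]
      field_simp
      ring
    have hs0 : P (shift V vm) (shift U (quadVal β (U, vm, V))) ≠ 0 := by
      rw [hs]
      positivity
    refine ⟨hs0, fun s => ?_⟩
    refine Fin.cases ?_ (fun k => ?_) s
    · rw [wt_zero, hs, Fin.cons_zero]
      field_simp
    · simp
  obtain ⟨hPi, hwi⟩ := edge hi h.left_ne h.base_left
  obtain ⟨hPj, hwj⟩ := edge hj h.right_ne h.base_right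
  have hc (s : Fin (n + 1)) : (Fin.cons (V 0 / ∏ s, V s) (fun _ => 1) : Vec (n + 1)) s ≠ 0 := by
    refine Fin.cases ?_ (fun k => ?_) s
    · exact div_ne_zero (h.base_ne 0) hPV
    · simp
  have hmem := mem_crossMap_of_wt (fun k => by simpa using h.base_ne k.succ)
    (fun k => by simpa using h.left_ne k.succ) (fun k => by simpa using h.right_ne k.succ)
    hPi hPj fun s => by
      rw [hwi, hwj]
      refine fun he => h.left_right s ?_
      simpa using mul_left_cancel₀ (hc s) he
  convert hmem using 1
  funext s
  rw [hwi, hwj, mul_assoc, mul_assoc, ← mul_sub, ← mul_sub, mul_div_mul_left _ _ (hc s)]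
  refine Fin.lastCases ?_ (fun k => ?_) s
  · simpa using h.quadVal_cross_eq hj vm
  · rw [shift_castSucc, h.crossVal_apply]
    simp

theorem corner_eq (h : FaceGood βi βj V Vi Vj) (hi : βi ≠ 0) (hj : βj ≠ 0) (vm : ℝ) :
    quadVal βi (crossVal βi βj (Vi, Vj, V), quadVal βj (Vj, vm, V), Vj) =
      quadVal βj (crossVal βi βj (Vi, Vj, V), quadVal βi (Vi, vm, V), Vi) := by
  have h1 := h.symm.quadVal_cross_eq hi vm
  rw [crossVal_symm] at h1
  rw [h1, h.quadVal_cross_eq hj vm, ← neg_div_neg_eq, neg_sub, neg_sub]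

end FaceGood

/-! ### Divided differences and consistency on a cube -/

theorem wt_ne_zero {β : ℝ} {V Vi : Vec (n + 1)} (hβ : β ≠ 0) (h : ∀ s, V s ≠ Vi s)
    (s : Fin (n + 1)) : wt β V Vi s ≠ 0 := by
  refine Fin.cases ?_ (fun k => ?_) s
  · exact div_ne_zero hβ (P_ne_zero.2 h)
  · exact sub_ne_zero.2 (inv_injective.ne (h k.castSucc).symm)

/-- The nodes of the divided differences which express the values at the corner of a cube. -/
noncomputable def pole (β : ℝ) (V Vi : Vec (n + 1)) : Vec (n + 1) :=
  Fin.cons (V (Fin.last n) - Vi (Fin.last n))⁻¹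
    fun k : Fin n => (wt β V Vi k.castSucc * Vi k.castSucc)⁻¹

@[simp] theorem pole_zero (β : ℝ) (V Vi : Vec (n + 1)) :
    pole β V Vi 0 = (V (Fin.last n) - Vi (Fin.last n))⁻¹ := rfl

@[simp] theorem pole_succ (β : ℝ) (V Vi : Vec (n + 1)) (k : Fin n) :
    pole β V Vi k.succ = (wt β V Vi k.castSucc * Vi k.castSucc)⁻¹ := rfl

theorem pole_ne_zero {β : ℝ} {V Vi : Vec (n + 1)} (hβ : β ≠ 0) (h : ∀ s, V s ≠ Vi s)
    (hi : ∀ s, Vi s ≠ 0) (s : Fin (n + 1)) : pole β V Vi s ≠ 0 := by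
  refine Fin.cases ?_ (fun k => ?_) s
  · exact inv_ne_zero (sub_ne_zero.2 (h _))
  · exact inv_ne_zero (mul_ne_zero (wt_ne_zero hβ h _) (hi _))

/-- `ai (yj - yk) + aj (yk - yi) + ak (yi - yj)`, the second divided difference without
denominator. -/
def cyc (ai aj ak yi yj yk : ℝ) : ℝ := ai * (yj - yk) + aj * (yk - yi) + ak * (yi - yj)

theorem cyc_swap_left (ai aj ak yi yj yk : ℝ) :
    cyc aj ai ak yj yi yk = -cyc ai aj ak yi yj yk := by
  unfold cyc; ring

theorem cyc_swap_right (ai aj ak yi yj yk : ℝ) :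
    cyc ai ak aj yi yk yj = -cyc ai aj ak yi yj yk := by
  unfold cyc; ring

/-- Weights that are first divided differences of `a`, applied to quotients of first differences of
`a v` and `a`, produce a quotient of second divided differences. The factor `D` common to both
weights cancels. -/
theorem divided_difference_step {ai aj ak yi yj yk : ℝ} (vi vj vk D : ℝ) (hD : D ≠ 0)
    (hij : yi ≠ yj) (hik : yi ≠ yk) (aij : ai ≠ aj) (aik : ai ≠ ak)
    (hN : cyc ai aj ak yi yj yk ≠ 0) :
    D * ((aj - ai) / (yj - yi)) ≠ D * ((ak - ai) / (yk - yi)) ∧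
    (D * ((ak - ai) / (yk - yi)) * ((ak * vk - ai * vi) / (ak - ai)) -
      D * ((aj - ai) / (yj - yi)) * ((aj * vj - ai * vi) / (aj - ai))) /
      (D * ((ak - ai) / (yk - yi)) - D * ((aj - ai) / (yj - yi))) =
      cyc (ai * vi) (aj * vj) (ak * vk) yi yj yk / cyc ai aj ak yi yj yk := by
  have h1 := sub_ne_zero.2 hij.symm
  have h2 := sub_ne_zero.2 hik.symm
  have h3 := sub_ne_zero.2 aij.symm
  have h4 := sub_ne_zero.2 aik.symm
  have e1 : D * ((ak - ai) / (yk - yi)) - D * ((aj - ai) / (yj - yi)) =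
      -(D / ((yk - yi) * (yj - yi))) * cyc ai aj ak yi yj yk := by
    unfold cyc
    field_simp
    ring
  have e2 : D * ((ak - ai) / (yk - yi)) * ((ak * vk - ai * vi) / (ak - ai)) -
      D * ((aj - ai) / (yj - yi)) * ((aj * vj - ai * vi) / (aj - ai)) =
      -(D / ((yk - yi) * (yj - yi))) * cyc (ai * vi) (aj * vj) (ak * vk) yi yj yk := by
    unfold cyc
    field_simp
    ring
  have h5 : -(D / ((yk - yi) * (yj - yi))) ≠ 0 := neg_ne_zero.2 (div_ne_zero hD (mul_ne_zero h2 h1))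
  refine ⟨fun h => mul_ne_zero h5 hN ?_, ?_⟩
  · rw [← e1, h, sub_self]
  · rw [e1, e2, mul_div_mul_left _ _ h5]

namespace FaceGood

variable {βi βj : ℝ} {V Vi Vj : Vec (n + 1)}

theorem crossVal_ne_zero (h : FaceGood βi βj V Vi Vj) (k : Fin n)
    (hp : pole βi V Vi k.succ ≠ pole βj V Vj k.succ) :
    crossVal βi βj (Vi, Vj, V) k.castSucc ≠ 0 := by
  rw [h.crossVal_apply]
  refine div_ne_zero (fun he => hp ?_) (sub_ne_zero.2 (h.wt_ne_wt _).symm)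
  rw [pole_succ, pole_succ, sub_eq_zero.1 he]

/-- The nodes `pole` are chosen so that this holds: the factor before the divided difference
involves only `V` and `Vi`, hence is the same for the edges from `Vi` in the directions `j` and `k`.
-/
theorem wt_left_crossVal (h : FaceGood βi βj V Vi Vj) (hi : βi ≠ 0) (hj : βj ≠ 0)
    (hp : ∀ s, pole βi V Vi s ≠ pole βj V Vj s) (s : Fin (n + 1)) :
    wt βj Vi (crossVal βi βj (Vi, Vj, V)) s =
      -(pole βi V Vi s * (Fin.cons ((∏ k : Fin n, V k.castSucc) / ∏ k : Fin n, Vi k.castSucc)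
        (fun _ => 1) : Vec (n + 1)) s) *
      ((wt βj V Vj s - wt βi V Vi s) / (pole βj V Vj s - pole βi V Vi s)) := by
  refine Fin.cases ?_ (fun k => ?_) s
  · have h1 : ∏ k : Fin n, V k.castSucc ≠ 0 := Finset.prod_ne_zero_iff.2 fun k _ => h.base_ne _
    have h2 : ∏ k : Fin n, Vi k.castSucc ≠ 0 := Finset.prod_ne_zero_iff.2 fun k _ => h.left_ne _
    have h3 := sub_ne_zero.2 (h.left_right (Fin.last n))
    have h4 := sub_ne_zero.2 (h.base_right (Fin.last n))
    have h5 := sub_ne_zero.2 (h.base_left (Fin.last n))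
    have h6 := h.P_right
    have h7 : wt βj V Vj 0 - wt βi V Vi 0 ≠ 0 := sub_ne_zero.2 h.wt_ne.symm
    have hjP : wt βj V Vj 0 * P V Vj = βj := div_mul_cancel₀ _ h6
    have h11 : wt βj V Vj 0 ≠ 0 := div_ne_zero hj h6
    have e : (V (Fin.last n) - Vj (Fin.last n))⁻¹ - (V (Fin.last n) - Vi (Fin.last n))⁻¹ =
        -(Vi (Fin.last n) - Vj (Fin.last n)) /
          ((V (Fin.last n) - Vj (Fin.last n)) * (V (Fin.last n) - Vi (Fin.last n))) := by
      field_simp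
      ring
    rw [wt_zero βj Vi, h.P_left_crossVal, pole_zero, pole_zero, e, Fin.cons_zero]
    nth_rewrite 1 [← hjP]
    field_simp
  · have hw1 := wt_ne_zero hi h.base_left k.castSucc
    have hw2 := wt_ne_zero hj h.base_right k.castSucc
    have h1 := h.left_ne k.castSucc
    have h2 := h.right_ne k.castSucc
    have h3 := sub_ne_zero.2 (h.wt_ne_wt k.castSucc).symm
    have h4 : wt βj V Vj k.castSucc * Vj k.castSucc -
        wt βi V Vi k.castSucc * Vi k.castSucc ≠ 0 := by
      intro he
      exact hp k.succ (by rw [pole_succ, pole_succ, sub_eq_zero.1 he])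
    rw [wt_succ, wt_succ, wt_succ, pole_succ, pole_succ, h.crossVal_apply, Fin.cons_succ]
    have e : (wt βj V Vj k.castSucc * Vj k.castSucc)⁻¹ -
        (wt βi V Vi k.castSucc * Vi k.castSucc)⁻¹ =
        -(wt βj V Vj k.castSucc * Vj k.castSucc - wt βi V Vi k.castSucc * Vi k.castSucc) /
        ((wt βj V Vj k.castSucc * Vj k.castSucc) * (wt βi V Vi k.castSucc * Vi k.castSucc)) := by
      field_simp
      ring
    rw [e]
    field_simp
    ring

end FaceGood

/-- Nondegenerate initial data for a cube in the directions `i`, `j`, `k`. -/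
structure CubeGood (βi βj βk : ℝ) (V Vi Vj Vk : Vec (n + 1)) : Prop where
  ij : FaceGood βi βj V Vi Vj
  ik : FaceGood βi βk V Vi Vk
  jk : FaceGood βj βk V Vj Vk
  pole_ij : ∀ s, pole βi V Vi s ≠ pole βj V Vj s
  pole_ik : ∀ s, pole βi V Vi s ≠ pole βk V Vk s
  pole_jk : ∀ s, pole βj V Vj s ≠ pole βk V Vk s
  cyc_ne : ∀ s, cyc (wt βi V Vi s) (wt βj V Vj s) (wt βk V Vk s)
    (pole βi V Vi s) (pole βj V Vj s) (pole βk V Vk s) ≠ 0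

/-- The values at the corner of a cube opposite to `V`. -/
noncomputable def cubeVal (βi βj βk : ℝ) (V Vi Vj Vk : Vec (n + 1)) : Vec (n + 1) := fun s =>
  cyc (wt βi V Vi s * Vi s) (wt βj V Vj s * Vj s) (wt βk V Vk s * Vk s)
    (pole βi V Vi s) (pole βj V Vj s) (pole βk V Vk s) /
  cyc (wt βi V Vi s) (wt βj V Vj s) (wt βk V Vk s)
    (pole βi V Vi s) (pole βj V Vj s) (pole βk V Vk s)

theorem cubeVal_swap_left (βi βj βk : ℝ) (V Vi Vj Vk : Vec (n + 1)) :
    cubeVal βj βi βk V Vj Vi Vk = cubeVal βi βj βk V Vi Vj Vk := by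
  funext s
  simp only [cubeVal]
  rw [cyc_swap_left, cyc_swap_left (wt βi V Vi s), neg_div_neg_eq]

theorem cubeVal_swap_right (βi βj βk : ℝ) (V Vi Vj Vk : Vec (n + 1)) :
    cubeVal βi βk βj V Vi Vk Vj = cubeVal βi βj βk V Vi Vj Vk := by
  funext s
  simp only [cubeVal]
  rw [cyc_swap_right, cyc_swap_right (wt βi V Vi s), neg_div_neg_eq]

namespace CubeGood

variable {βi βj βk : ℝ} {V Vi Vj Vk : Vec (n + 1)}

theorem swap_left (h : CubeGood βi βj βk V Vi Vj Vk) : CubeGood βj βi βk V Vj Vi Vk where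
  ij := h.ij.symm
  ik := h.jk
  jk := h.ik
  pole_ij s := (h.pole_ij s).symm
  pole_ik := h.pole_jk
  pole_jk := h.pole_ik
  cyc_ne s := by
    rw [cyc_swap_left]
    exact neg_ne_zero.2 (h.cyc_ne s)

theorem swap_right (h : CubeGood βi βj βk V Vi Vj Vk) : CubeGood βi βk βj V Vi Vk Vj where
  ij := h.ik
  ik := h.ij
  jk := h.jk.symm
  pole_ij := h.pole_ik
  pole_ik := h.pole_ij
  pole_jk s := (h.pole_jk s).symm
  cyc_ne s := by
    rw [cyc_swap_right]
    exact neg_ne_zero.2 (h.cyc_ne s)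

/-- One of the three ways to reach the far corner; the other two follow by permuting directions,
since `cyc` is antisymmetric and `cubeVal` therefore symmetric. -/
theorem cubeVal_mem (h : CubeGood βi βj βk V Vi Vj Vk) (hi : βi ≠ 0) (hj : βj ≠ 0)
    (hk : βk ≠ 0) : cubeVal βi βj βk V Vi Vj Vk ∈
      crossMap βj βk (crossVal βi βj (Vi, Vj, V), crossVal βi βk (Vi, Vk, V), Vi) := by
  have h1 : ∏ k : Fin n, V k.castSucc ≠ 0 := Finset.prod_ne_zero_iff.2 fun k _ => h.ij.base_ne _
  have h2 : ∏ k : Fin n, Vi k.castSucc ≠ 0 := Finset.prod_ne_zero_iff.2 fun k _ => h.ij.left_ne _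
  have step (s : Fin (n + 1)) := divided_difference_step (Vi s) (Vj s) (Vk s)
    (-(pole βi V Vi s * (Fin.cons ((∏ k : Fin n, V k.castSucc) / ∏ k : Fin n, Vi k.castSucc)
        (fun _ => 1) : Vec (n + 1)) s))
    (neg_ne_zero.2 (mul_ne_zero (pole_ne_zero hi h.ij.base_left h.ij.left_ne s)
      (Fin.cases (div_ne_zero h1 h2) (fun _ => one_ne_zero) s)))
    (h.pole_ij s) (h.pole_ik s) (h.ij.wt_ne_wt s) (h.ik.wt_ne_wt s) (h.cyc_ne s)
  have hw1 := h.ij.wt_left_crossVal hi hj h.pole_ij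
  have hw2 := h.ik.wt_left_crossVal hi hk h.pole_ik
  have hmem := mem_crossMap_of_wt (βi := βj) (βj := βk) (fun k => h.ij.left_ne k.castSucc)
    (fun k => h.ij.crossVal_ne_zero k (h.pole_ij _)) (fun k => h.ik.crossVal_ne_zero k (h.pole_ik _))
    (h.ij.P_left_crossVal_ne_zero hj) (h.ik.P_left_crossVal_ne_zero hk) fun s => by
      rw [hw1, hw2]
      exact (step s).1
  convert hmem using 1
  funext s
  rw [hw1, hw2, h.ij.crossVal_apply, h.ik.crossVal_apply, (step s).2]
  rfl

end CubeGood

/-! ### Nondegenerate initial data are generic -/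

section Density

variable {κ : Type*} {o i j k : κ} {βi βj βk : ℝ}

theorem _root_.ContinuousAt.wt {X : Type*} [TopologicalSpace X] {A B : X → Vec (n + 1)} {x : X}
    (β : ℝ) (hA : ContinuousAt A x) (hB : ContinuousAt B x) (h : ∀ s, A x s ≠ B x s)
    (hA0 : ∀ s, A x s ≠ 0) (hB0 : ∀ s, B x s ≠ 0) (s : Fin (n + 1)) :
    ContinuousAt (fun y => MultiQuad.wt β (A y) (B y) s) x := by
  refine Fin.cases ?_ (fun k => ?_) s
  · simp only [wt_zero]
    exact continuousAt_const.div (hA.P hB) (P_ne_zero.2 h)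
  · simp only [wt_succ]
    exact ((continuousAt_pi.1 hB _).inv₀ (hB0 _)).sub ((continuousAt_pi.1 hA _).inv₀ (hA0 _))

theorem _root_.ContinuousAt.pole {X : Type*} [TopologicalSpace X] {A B : X → Vec (n + 1)} {x : X}
    {β : ℝ} (hβ : β ≠ 0) (hA : ContinuousAt A x) (hB : ContinuousAt B x) (h : ∀ s, A x s ≠ B x s)
    (hA0 : ∀ s, A x s ≠ 0) (hB0 : ∀ s, B x s ≠ 0) (s : Fin (n + 1)) :
    ContinuousAt (fun y => MultiQuad.pole β (A y) (B y) s) x := by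
  refine Fin.cases ?_ (fun k => ?_) s
  · simp only [pole_zero]
    exact ((continuousAt_pi.1 hA _).sub (continuousAt_pi.1 hB _)).inv₀ (sub_ne_zero.2 (h _))
  · simp only [pole_succ]
    exact ((hA.wt β hB h hA0 hB0 _).mul (continuousAt_pi.1 hB _)).inv₀
      (mul_ne_zero (wt_ne_zero hβ h _) (hB0 _))

theorem continuousAt_eval (o : κ) (W : κ → Vec (n + 1)) :
    ContinuousAt (fun W : κ → Vec (n + 1) => W o) W :=
  (continuous_apply o).continuousAt

theorem eventually_apply_ne_zero (o : κ) (s : Fin (n + 1)) :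
    ∀ᶠ W in denseInterior (κ → Vec (n + 1)), W o s ≠ 0 :=
  eventually_ne_zero (p := fun _ => True) (Eventually.of_forall fun _ => trivial) (fun W => W o s)
    (fun W _ => continuousAt_pi.1 (continuousAt_eval o W) s) o s fun W W' _ _ _ _ h h' => by rw [h, h']

theorem eventually_apply_ne (hoi : o ≠ i) (s : Fin (n + 1)) :
    ∀ᶠ W in denseInterior (κ → Vec (n + 1)), W o s ≠ W i s := by
  have := eventually_ne_zero (κ := κ) (m := n + 1) (p := fun _ => True)
    (Eventually.of_forall fun _ => trivial) (fun W => W o s - W i s)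
    (fun W _ => (continuousAt_pi.1 (continuousAt_eval o W) s).sub
      (continuousAt_pi.1 (continuousAt_eval i W) s)) o s fun W W' _ _ h1 _ h h' => by
      have := congrFun (h1 i hoi.symm) s
      linarith
  filter_upwards [this] with W hW
  exact sub_ne_zero.1 hW

/-- A change of a single component of `Vi` changes `P V Vi`. -/
theorem eq_of_P_eq {V Vi Vi' : Vec (n + 1)} (s : Fin (n + 1)) (h : ∀ l, l ≠ s → Vi' l = Vi l)
    (hne : ∀ l, V l ≠ Vi l) (hP : P V Vi = P V Vi') : Vi' s = Vi s := by
  have h0 : ∏ l ∈ Finset.univ.erase s, (V l - Vi l) ≠ 0 :=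
    Finset.prod_ne_zero_iff.2 fun l _ => sub_ne_zero.2 (hne l)
  have h1 : ∏ l ∈ Finset.univ.erase s, (V l - Vi' l) = ∏ l ∈ Finset.univ.erase s, (V l - Vi l) :=
    Finset.prod_congr rfl fun l hl => by rw [h l (Finset.ne_of_mem_erase hl)]
  unfold P at hP
  rw [← Finset.mul_prod_erase _ _ (Finset.mem_univ s),
    ← Finset.mul_prod_erase _ (fun l => V l - Vi' l) (Finset.mem_univ s), h1] at hP
  have := mul_right_cancel₀ h0 hP
  linarith

/-- With the other components fixed this is injectivity of `x ↦ x / (V s - x)`, which needs `V s ≠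
0`. -/
theorem eq_of_mul_P_eq {V Vi Vi' : Vec (n + 1)} (s : Fin (n + 1)) (h : ∀ l, l ≠ s → Vi' l = Vi l)
    (hne : ∀ l, V l ≠ Vi l) (hV : V s ≠ 0) (hP : Vi' s * P V Vi = Vi s * P V Vi') :
    Vi' s = Vi s := by
  have h0 : ∏ l ∈ Finset.univ.erase s, (V l - Vi l) ≠ 0 :=
    Finset.prod_ne_zero_iff.2 fun l _ => sub_ne_zero.2 (hne l)
  have h1 : ∏ l ∈ Finset.univ.erase s, (V l - Vi' l) = ∏ l ∈ Finset.univ.erase s, (V l - Vi l) :=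
    Finset.prod_congr rfl fun l hl => by rw [h l (Finset.ne_of_mem_erase hl)]
  unfold P at hP
  rw [← Finset.mul_prod_erase _ _ (Finset.mem_univ s),
    ← Finset.mul_prod_erase _ (fun l => V l - Vi' l) (Finset.mem_univ s), h1,
    ← mul_assoc, ← mul_assoc] at hP
  have := mul_right_cancel₀ h0 hP
  exact mul_left_cancel₀ hV (by linarith)

theorem eventually_faceGood (hi : βi ≠ 0) (hoi : o ≠ i) (hoj : o ≠ j) (hij : i ≠ j) :
    ∀ᶠ W in denseInterior (κ → Vec (n + 1)), FaceGood βi βj (W o) (W i) (W j) := by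
  have hbase : ∀ᶠ W in denseInterior (κ → Vec (n + 1)), (∀ s, W o s ≠ 0) ∧ (∀ s, W i s ≠ 0) ∧
      (∀ s, W j s ≠ 0) ∧ (∀ s, W o s ≠ W i s) ∧ (∀ s, W o s ≠ W j s) ∧ ∀ s, W i s ≠ W j s :=
    (eventually_all.2 (eventually_apply_ne_zero o)).and <|
      (eventually_all.2 (eventually_apply_ne_zero i)).and <|
      (eventually_all.2 (eventually_apply_ne_zero j)).and <|
      (eventually_all.2 (eventually_apply_ne hoi)).and <|
      (eventually_all.2 (eventually_apply_ne hoj)).and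
      (eventually_all.2 (eventually_apply_ne hij))
  have hw := eventually_ne_zero hbase
    (fun W => wt βi (W o) (W i) 0 - wt βj (W o) (W j) 0)
    (fun W ⟨h1, h2, h3, h4, h5, _⟩ => ((continuousAt_eval o W).wt βi (continuousAt_eval i W) h4 h1 h2 0).sub
      ((continuousAt_eval o W).wt βj (continuousAt_eval j W) h5 h1 h3 0)) i 0 fun W W' h h' hr hl hc hc' => by
    simp only [wt_zero] at hc hc'
    rw [hr o hoi, hr j hij.symm] at hc'
    refine eq_of_P_eq 0 hl h.2.2.2.1 ?_
    have h1 : P (W o) (W i) ≠ 0 := P_ne_zero.2 h.2.2.2.1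
    have h2 : P (W o) (W' i) ≠ 0 := by
      rw [← hr o hoi]
      exact P_ne_zero.2 h'.2.2.2.1
    have : βi / P (W o) (W i) = βi / P (W o) (W' i) := by linarith
    rw [div_eq_div_iff h1 h2] at this
    exact (mul_left_cancel₀ hi this).symm
  filter_upwards [hbase, hw] with W h h'
  exact ⟨h.1, h.2.1, h.2.2.1, h.2.2.2.1, h.2.2.2.2.1, h.2.2.2.2.2, sub_ne_zero.1 h'⟩

/-- A component of `Vi` which enters the weight with the given index, but not the next one. -/
theorem exists_wt_injective (hi : βi ≠ 0) (l : Fin n) : ∃ s : Fin (n + 1), s ≠ l.castSucc ∧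
    ∀ {V Vi Vi' : Vec (n + 1)}, (∀ r, V r ≠ Vi r) → (∀ r, V r ≠ Vi' r) →
      (∀ r, r ≠ s → Vi' r = Vi r) → wt βi V Vi l.castSucc = wt βi V Vi' l.castSucc →
      Vi' s = Vi s := by
  obtain ⟨n, rfl⟩ : ∃ N, n = N + 1 := ⟨n - 1, by have := l.isLt; omega⟩
  refine Fin.cases ?_ (fun r => ?_) l
  -- The weight of index `0` involves all components through `P`, so the last one serves; the weight
  -- of index `r + 1` involves only the component `r`.
  · refine ⟨Fin.last _, (Fin.castSucc_lt_last 0).ne', fun {V Vi Vi'} h h' hl hw => ?_⟩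
    refine eq_of_P_eq _ hl h ?_
    rw [Fin.castSucc_zero, wt_zero, wt_zero,
      div_eq_div_iff (P_ne_zero.2 h) (P_ne_zero.2 h')] at hw
    exact (mul_left_cancel₀ hi hw).symm
  · refine ⟨r.castSucc.castSucc, ?_, fun {V Vi Vi'} h h' hl hw => ?_⟩
    · simp [Fin.ext_iff]
    · rw [← Fin.succ_castSucc, wt_succ, wt_succ] at hw
      exact (inv_injective (sub_left_injective hw)).symm

theorem eventually_pole_ne (hi : βi ≠ 0) (hj : βj ≠ 0) (hoi : o ≠ i) (hoj : o ≠ j) (hij : i ≠ j)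
    (s : Fin (n + 1)) :
    ∀ᶠ W in denseInterior (κ → Vec (n + 1)), pole βi (W o) (W i) s ≠ pole βj (W o) (W j) s := by
  have hface := eventually_faceGood (n := n) (βj := βj) hi hoi hoj hij
  have hc (W : κ → Vec (n + 1)) (h : FaceGood βi βj (W o) (W i) (W j)) :
      ContinuousAt (fun W => pole βi (W o) (W i) s - pole βj (W o) (W j) s) W :=
    ((continuousAt_eval o W).pole hi (continuousAt_eval i W) h.base_left h.base_ne h.left_ne s).sub
      ((continuousAt_eval o W).pole hj (continuousAt_eval j W) h.base_right h.base_ne h.right_ne s)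
  induction s using Fin.cases with
  | zero =>
    filter_upwards [hface] with W h
    rw [pole_zero, pole_zero]
    exact inv_injective.ne (sub_right_injective.ne (h.left_right _))
  | succ l =>
    suffices ∀ᶠ W in denseInterior (κ → Vec (n + 1)),
        pole βi (W o) (W i) l.succ - pole βj (W o) (W j) l.succ ≠ 0 by
      filter_upwards [this] with W hW
      exact sub_ne_zero.1 hW
    by_cases hl0 : l.castSucc = 0
    · refine eventually_ne_zero hface _ hc i 0 fun W W' h h' hr hl hc hc' => ?_
      simp only [pole_succ, hr o hoi, hr j hij.symm, hl0, wt_zero] at hc hc'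
      have hb' := h'.base_left
      rw [hr o hoi] at hb'
      refine eq_of_mul_P_eq 0 hl h.base_left (h.base_ne 0) ?_
      have h1 : P (W o) (W i) ≠ 0 := P_ne_zero.2 h.base_left
      have h2 : P (W o) (W' i) ≠ 0 := P_ne_zero.2 hb'
      have : (βi / P (W o) (W i) * W i 0) = (βi / P (W o) (W' i) * W' i 0) :=
        inv_injective (by linarith)
      field_simp at this
      linarith
    · obtain ⟨s, hs, hinj⟩ := exists_wt_injective hi l
      refine eventually_ne_zero hface _ hc i s fun W W' h h' hr hl hc hc' => ?_
      simp only [pole_succ, hr o hoi, hr j hij.symm, hl _ hs.symm] at hc hc'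
      have hb' := h'.base_left
      rw [hr o hoi] at hb'
      refine hinj h.base_left hb' hl ?_
      exact mul_right_cancel₀ (h.left_ne l.castSucc) (inv_injective (by linarith))

/-- A single component of `W j` is varied, chosen so that for `m > 1` it moves either the weight or
the node of the edge `j`, but not both; `cyc` is then affine in the moved quantity with nonzero
slope. -/
theorem eventually_cyc_ne (hi : βi ≠ 0) (hj : βj ≠ 0) (hk : βk ≠ 0) (hne : n = 0 → βi ≠ βk)
    (hoi : o ≠ i) (hoj : o ≠ j) (hok : o ≠ k) (hij : i ≠ j) (hik : i ≠ k) (hjk : j ≠ k)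
    (s : Fin (n + 1)) :
    ∀ᶠ W in denseInterior (κ → Vec (n + 1)),
      cyc (wt βi (W o) (W i) s) (wt βj (W o) (W j) s) (wt βk (W o) (W k) s)
        (pole βi (W o) (W i) s) (pole βj (W o) (W j) s) (pole βk (W o) (W k) s) ≠ 0 := by
  have hface := ((eventually_faceGood (n := n) (βj := βj) hi hoi hoj hij).and
    (eventually_faceGood (n := n) (βj := βk) hi hoi hok hik)).and
    (eventually_pole_ne hi hk hoi hok hik s)
  have hc (W : κ → Vec (n + 1)) (h : (FaceGood βi βj (W o) (W i) (W j) ∧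
      FaceGood βi βk (W o) (W i) (W k)) ∧ pole βi (W o) (W i) s ≠ pole βk (W o) (W k) s) :
      ContinuousAt (fun W => cyc (wt βi (W o) (W i) s) (wt βj (W o) (W j) s) (wt βk (W o) (W k) s)
        (pole βi (W o) (W i) s) (pole βj (W o) (W j) s) (pole βk (W o) (W k) s)) W := by
    have ho : ContinuousAt (fun W : κ → Vec (n + 1) => W o) W := continuousAt_eval o W
    have hWi : ContinuousAt (fun W : κ → Vec (n + 1) => W i) W := continuousAt_eval i W
    have hWj : ContinuousAt (fun W : κ → Vec (n + 1) => W j) W := continuousAt_eval j W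
    have hWk : ContinuousAt (fun W : κ → Vec (n + 1) => W k) W := continuousAt_eval k W
    obtain ⟨⟨h1, h2⟩, -⟩ := h
    have a1 := ho.wt βi hWi h1.base_left h1.base_ne h1.left_ne s
    have a2 := ho.wt βj hWj h1.base_right h1.base_ne h1.right_ne s
    have a3 := ho.wt βk hWk h2.base_right h2.base_ne h2.right_ne s
    have b1 := ho.pole hi hWi h1.base_left h1.base_ne h1.left_ne s
    have b2 := ho.pole hj hWj h1.base_right h1.base_ne h1.right_ne s
    have b3 := ho.pole hk hWk h2.base_right h2.base_ne h2.right_ne s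
    exact ((a1.mul (b2.sub b3)).add (a2.mul (b3.sub b1))).add (a3.mul (b1.sub b2))
  induction s using Fin.cases with
  | zero =>
    refine eventually_ne_zero hface _ hc j 0 fun W W' ⟨⟨h1, h2⟩, h3⟩ ⟨⟨h1', h2'⟩, _⟩ hr hl hc hc' => ?_
    simp only [hr o hoj, hr i hij, hr k hjk.symm] at hc'
    have hb' := h1'.base_right
    rw [hr o hoj] at hb'
    rcases Nat.eq_zero_or_pos n with rfl | hn
    · have hw {β : ℝ} {V U : Vec 1} : wt β V U 0 = β * pole β V U 0 := by
        simp [P, div_eq_mul_inv]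
      simp only [hw] at hc hc'
      have p1 := pole_ne_zero hi h1.base_left h1.left_ne 0
      have p3 := pole_ne_zero hk h2.base_right h2.right_ne 0
      generalize pole βi (W o) (W i) 0 = yi at *
      generalize pole βk (W o) (W k) 0 = yk at *
      have hy : (pole βj (W o) (W j) 0 - pole βj (W o) (W' j) 0) *
          (βi * yi + βj * (yk - yi) - βk * yk) = 0 := by
        unfold cyc at hc hc'
        linear_combination hc - hc'
      rcases mul_eq_zero.1 hy with hy | hy
      · have := inv_injective (sub_eq_zero.1 hy)
        have := sub_right_injective this
        exact this.symm
      · exfalso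
        have : (βi - βk) * (yi * yk) = 0 := by
          unfold cyc at hc
          linear_combination pole βj (W o) (W j) 0 * hy - hc
        rcases mul_eq_zero.1 this with h | h
        · exact hne rfl (by linarith)
        · exact mul_ne_zero p1 p3 h
    -- The node of index `0` sees only the last component, so moving the component `0` changes the
    -- weight alone.
    · have hlast : Fin.last n ≠ 0 := by simp [Fin.ext_iff]; omega
      have hp : pole βj (W o) (W' j) 0 = pole βj (W o) (W j) 0 := by
        rw [pole_zero, pole_zero, hl _ hlast]
      rw [hp] at hc'
      have hy : (wt βj (W o) (W j) 0 - wt βj (W o) (W' j) 0) *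
          (pole βk (W o) (W k) 0 - pole βi (W o) (W i) 0) = 0 := by
        unfold cyc at hc hc'
        linear_combination hc - hc'
      have := sub_eq_zero.1 ((mul_eq_zero.1 hy).resolve_right (sub_ne_zero.2 h3.symm))
      rw [wt_zero, wt_zero, div_eq_div_iff (P_ne_zero.2 h1.base_right) (P_ne_zero.2 hb')] at this
      exact eq_of_P_eq 0 hl h1.base_right (mul_left_cancel₀ hj this).symm
  | succ l =>
    -- The weight of index `l + 1` sees only the component `l`, so moving the component `s` changes
    -- the node alone.
    obtain ⟨s, hs, hinj⟩ := exists_wt_injective hj l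
    refine eventually_ne_zero hface _ hc j s fun W W' ⟨⟨h1, h2⟩, _⟩ ⟨⟨h1', h2'⟩, _⟩ hr hl hc hc' => ?_
    have hb' := h1'.base_right
    rw [hr o hoj] at hb'
    simp only [hr o hoj, hr i hij, hr k hjk.symm, wt_succ, hl _ hs.symm] at hc hc'
    have hy : ((W i l.castSucc)⁻¹ - (W k l.castSucc)⁻¹) *
        (pole βj (W o) (W j) l.succ - pole βj (W o) (W' j) l.succ) = 0 := by
      unfold cyc at hc hc'
      linear_combination hc - hc'
    have := sub_eq_zero.1 ((mul_eq_zero.1 hy).resolve_left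
      (sub_ne_zero.2 (inv_injective.ne (h2.left_right _))))
    rw [pole_succ, pole_succ, hl _ hs.symm] at this
    exact hinj h1.base_right hb' hl (mul_right_cancel₀ (h1.right_ne _) (inv_injective this))

theorem eventually_cubeGood (hi : βi ≠ 0) (hj : βj ≠ 0) (hk : βk ≠ 0) (hne : n = 0 → βi ≠ βk)
    (hoi : o ≠ i) (hoj : o ≠ j) (hok : o ≠ k) (hij : i ≠ j) (hik : i ≠ k) (hjk : j ≠ k) :
    ∀ᶠ W in denseInterior (κ → Vec (n + 1)), CubeGood βi βj βk (W o) (W i) (W j) (W k) := by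
  filter_upwards [eventually_faceGood (n := n) (βj := βj) hi hoi hoj hij,
    eventually_faceGood (n := n) (βj := βk) hi hoi hok hik,
    eventually_faceGood (n := n) (βj := βk) hj hoj hok hjk,
    eventually_all.2 (eventually_pole_ne (n := n) hi hj hoi hoj hij),
    eventually_all.2 (eventually_pole_ne (n := n) hi hk hoi hok hik),
    eventually_all.2 (eventually_pole_ne (n := n) hj hk hoj hok hjk),
    eventually_all.2 (eventually_cyc_ne (n := n) hi hj hk hne hoi hoj hok hij hik hjk)]
    with W h1 h2 h3 h4 h5 h6 h7
  exact ⟨h1, h2, h3, h4, h5, h6, h7⟩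

theorem eventually_cubeGood_prod (hi : βi ≠ 0) (hj : βj ≠ 0) (hk : βk ≠ 0)
    (hne : n = 0 → βi ≠ βk) :
    ∀ᶠ x in denseInterior (Vec (n + 1) × Vec (n + 1) × Vec (n + 1) × Vec (n + 1)),
      CubeGood βi βj βk x.1 x.2.1 x.2.2.1 x.2.2.2 := by
  let e : (Vec (n + 1) × Vec (n + 1) × Vec (n + 1) × Vec (n + 1)) ≃ₜ (Fin 4 → Vec (n + 1)) :=
    { toFun := fun x => ![x.1, x.2.1, x.2.2.1, x.2.2.2]
      invFun := fun W => (W 0, W 1, W 2, W 3)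
      left_inv := fun x => rfl
      right_inv := fun W => by ext l; fin_cases l <;> rfl
      continuous_toFun := by
        refine continuous_pi fun l => ?_
        fin_cases l
        · exact continuous_fst
        · exact continuous_fst.comp continuous_snd
        · exact continuous_fst.comp (continuous_snd.comp continuous_snd)
        · exact continuous_snd.comp (continuous_snd.comp continuous_snd)
      continuous_invFun := by fun_prop }
  refine (tendsto_denseInterior e.continuous e.isOpenMap).eventually (eventually_cubeGood (κ := Fin 4)
    (o := 0) (i := 1) (j := 2) (k := 3) hi hj hk hne (by decide) (by decide) (by decide)
    (by decide) (by decide) (by decide))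

theorem eventually_faceGood_prod (hi : βi ≠ 0) :
    ∀ᶠ x in denseInterior (Vec (n + 1) × Vec (n + 1) × Vec (n + 1)),
      FaceGood βi βj x.2.2 x.1 x.2.1 := by
  let e : (Vec (n + 1) × Vec (n + 1) × Vec (n + 1)) ≃ₜ (Fin 3 → Vec (n + 1)) :=
    { toFun := fun x => ![x.1, x.2.1, x.2.2]
      invFun := fun W => (W 0, W 1, W 2)
      left_inv := fun x => rfl
      right_inv := fun W => by ext l; fin_cases l <;> rfl
      continuous_toFun := by
        refine continuous_pi fun l => ?_
        fin_cases l
        · exact continuous_fst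
        · exact continuous_fst.comp continuous_snd
        · exact continuous_snd.comp continuous_snd
      continuous_invFun := by fun_prop }
  refine (tendsto_denseInterior e.continuous e.isOpenMap).eventually (eventually_faceGood (κ := Fin 3)
    (o := 2) (i := 0) (j := 1) hi (by decide) (by decide) (by decide))

theorem eventually_faceGood_prod_real (hi : βi ≠ 0) :
    ∀ᶠ x in denseInterior (ℝ × Vec (n + 1) × Vec (n + 1) × Vec (n + 1)),
      FaceGood βi βj x.2.1 x.2.2.1 x.2.2.2 := by
  let e : (Vec (n + 1) × Vec (n + 1) × Vec (n + 1)) ≃ₜ (Vec (n + 1) × Vec (n + 1) × Vec (n + 1)) :=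
    (Homeomorph.prodComm _ _).trans (Homeomorph.prodAssoc _ _ _)
  refine ((tendsto_denseInterior (e.continuous.comp continuous_snd)
    (e.isOpenMap.comp isOpenMap_snd)).eventually
    (eventually_faceGood_prod (n := n) hi)).mono fun _ h => h

end Density

/-! ### Continuous extensions of the composed maps -/

theorem extendedBy_crossMap (βi βj : ℝ) :
    ExtendedBy (X := Vec (n + 1) × Vec (n + 1) × Vec (n + 1))
      (fun (Vi, Vj, V) => crossMap βi βj (Vi, Vj, V)) (crossVal βi βj) := by
  rintro ⟨Vi, Vj, V⟩ a ha
  exact crossMap_extend (A := fun x : Vec (n + 1) × Vec (n + 1) × Vec (n + 1) => x.1)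
    (B := fun x => x.2.1) (C := fun x => x.2.2)
    (by fun_prop) (by fun_prop) (by fun_prop) ha

section Face

variable (βi βj : ℝ)

theorem extendedBy_face :
    ExtendedBy (X := ℝ × Vec (n + 1) × Vec (n + 1) × Vec (n + 1))
      (fun (vm, V, Vi, Vj) => do
        let vim ← quadMap βi (Vi, vm, V)
        let vjm ← quadMap βj (Vj, vm, V)
        crossMap βi βj (shift Vi vim, shift Vj vjm, shift V vm))
      (fun x => crossVal βi βj (shift x.2.2.1 (quadVal βi (x.2.2.1, x.1, x.2.1)),
        shift x.2.2.2 (quadVal βj (x.2.2.2, x.1, x.2.1)), shift x.2.1 x.1)) := by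
  intro x a ha
  obtain ⟨vim, h1, ha⟩ := Part.mem_bind_iff.1 ha
  obtain ⟨vjm, h2, ha⟩ := Part.mem_bind_iff.1 ha
  have c0 : ContinuousAt (fun x : ℝ × Vec (n + 1) × Vec (n + 1) × Vec (n + 1) => x.1) x := by
    fun_prop
  have cV : ContinuousAt (fun x : ℝ × Vec (n + 1) × Vec (n + 1) × Vec (n + 1) => x.2.1) x := by
    fun_prop
  have ci : ContinuousAt (fun x : ℝ × Vec (n + 1) × Vec (n + 1) × Vec (n + 1) => x.2.2.1) x := by
    fun_prop
  have cj : ContinuousAt (fun x : ℝ × Vec (n + 1) × Vec (n + 1) × Vec (n + 1) => x.2.2.2) x := by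
    fun_prop
  obtain ⟨c1, rfl⟩ := quadMap_extend ci c0 cV h1
  obtain ⟨c2, rfl⟩ := quadMap_extend cj c0 cV h2
  exact crossMap_extend (shift_continuousAt ci c1) (shift_continuousAt cj c2)
    (shift_continuousAt cV c0) ha

theorem extendedBy_corner_left :
    ExtendedBy (X := ℝ × Vec (n + 1) × Vec (n + 1) × Vec (n + 1))
      (fun (vm, V, Vi, Vj) => do
        let vjm ← quadMap βj (Vj, vm, V)
        let Vij ← crossMap βi βj (Vi, Vj, V)
        quadMap βi (Vij, vjm, Vj))
      (fun x => quadVal βi (crossVal βi βj (x.2.2.1, x.2.2.2, x.2.1),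
        quadVal βj (x.2.2.2, x.1, x.2.1), x.2.2.2)) := by
  intro x a ha
  obtain ⟨vim, h1, ha⟩ := Part.mem_bind_iff.1 ha
  obtain ⟨vjm, h2, ha⟩ := Part.mem_bind_iff.1 ha
  have c0 : ContinuousAt (fun x : ℝ × Vec (n + 1) × Vec (n + 1) × Vec (n + 1) => x.1) x := by
    fun_prop
  have cV : ContinuousAt (fun x : ℝ × Vec (n + 1) × Vec (n + 1) × Vec (n + 1) => x.2.1) x := by
    fun_prop
  have ci : ContinuousAt (fun x : ℝ × Vec (n + 1) × Vec (n + 1) × Vec (n + 1) => x.2.2.1) x := by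
    fun_prop
  have cj : ContinuousAt (fun x : ℝ × Vec (n + 1) × Vec (n + 1) × Vec (n + 1) => x.2.2.2) x := by
    fun_prop
  obtain ⟨c1, rfl⟩ := quadMap_extend cj c0 cV h1
  obtain ⟨c2, rfl⟩ := crossMap_extend ci cj cV h2
  exact quadMap_extend c2 c1 cj ha

theorem extendedBy_corner_right :
    ExtendedBy (X := ℝ × Vec (n + 1) × Vec (n + 1) × Vec (n + 1))
      (fun (vm, V, Vi, Vj) => do
        let vim ← quadMap βi (Vi, vm, V)
        let Vij ← crossMap βi βj (Vi, Vj, V)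
        quadMap βj (Vij, vim, Vi))
      (fun x => quadVal βj (crossVal βi βj (x.2.2.1, x.2.2.2, x.2.1),
        quadVal βi (x.2.2.1, x.1, x.2.1), x.2.2.1)) := by
  intro x a ha
  obtain ⟨vim, h1, ha⟩ := Part.mem_bind_iff.1 ha
  obtain ⟨vjm, h2, ha⟩ := Part.mem_bind_iff.1 ha
  have c0 : ContinuousAt (fun x : ℝ × Vec (n + 1) × Vec (n + 1) × Vec (n + 1) => x.1) x := by
    fun_prop
  have cV : ContinuousAt (fun x : ℝ × Vec (n + 1) × Vec (n + 1) × Vec (n + 1) => x.2.1) x := by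
    fun_prop
  have ci : ContinuousAt (fun x : ℝ × Vec (n + 1) × Vec (n + 1) × Vec (n + 1) => x.2.2.1) x := by
    fun_prop
  have cj : ContinuousAt (fun x : ℝ × Vec (n + 1) × Vec (n + 1) × Vec (n + 1) => x.2.2.2) x := by
    fun_prop
  obtain ⟨c1, rfl⟩ := quadMap_extend ci c0 cV h1
  obtain ⟨c2, rfl⟩ := crossMap_extend ci cj cV h2
  exact quadMap_extend c2 c1 ci ha

theorem extendedBy_shift_left :
    ExtendedBy (X := ℝ × Vec (n + 1) × Vec (n + 1) × Vec (n + 1))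
      (fun (vm, V, Vi, Vj) => do
        let vjm ← quadMap βj (Vj, vm, V)
        let Vij ← crossMap βi βj (Vi, Vj, V)
        let vijm ← quadMap βi (Vij, vjm, Vj)
        return shift Vij vijm)
      (fun x => shift (crossVal βi βj (x.2.2.1, x.2.2.2, x.2.1))
        (quadVal βi (crossVal βi βj (x.2.2.1, x.2.2.2, x.2.1),
          quadVal βj (x.2.2.2, x.1, x.2.1), x.2.2.2))) := by
  intro x a ha
  obtain ⟨vjm, h1, ha⟩ := Part.mem_bind_iff.1 ha
  obtain ⟨Vij, h2, ha⟩ := Part.mem_bind_iff.1 ha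
  obtain ⟨vijm, h3, ha⟩ := Part.mem_bind_iff.1 ha
  obtain ⟨c3, rfl⟩ := extendedBy_corner_left βi βj x vijm
    (Part.mem_bind_iff.2 ⟨_, h1, Part.mem_bind_iff.2 ⟨_, h2, h3⟩⟩)
  obtain ⟨c2, rfl⟩ := crossMap_extend
    (A := fun x : ℝ × Vec (n + 1) × Vec (n + 1) × Vec (n + 1) => x.2.2.1)
    (B := fun x => x.2.2.2) (C := fun x => x.2.1) (by fun_prop) (by fun_prop) (by fun_prop) h2
  exact ⟨shift_continuousAt c2 c3, (Part.mem_some_iff.1 ha).symm⟩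

theorem extendedBy_shift_right :
    ExtendedBy (X := ℝ × Vec (n + 1) × Vec (n + 1) × Vec (n + 1))
      (fun (vm, V, Vi, Vj) => do
        let vim ← quadMap βi (Vi, vm, V)
        let Vij ← crossMap βi βj (Vi, Vj, V)
        let vijm ← quadMap βj (Vij, vim, Vi)
        return shift Vij vijm)
      (fun x => shift (crossVal βi βj (x.2.2.1, x.2.2.2, x.2.1))
        (quadVal βj (crossVal βi βj (x.2.2.1, x.2.2.2, x.2.1),
          quadVal βi (x.2.2.1, x.1, x.2.1), x.2.2.1))) := by
  intro x a ha
  obtain ⟨vim, h1, ha⟩ := Part.mem_bind_iff.1 ha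
  obtain ⟨Vij, h2, ha⟩ := Part.mem_bind_iff.1 ha
  obtain ⟨vijm, h3, ha⟩ := Part.mem_bind_iff.1 ha
  obtain ⟨c3, rfl⟩ := extendedBy_corner_right βi βj x vijm
    (Part.mem_bind_iff.2 ⟨_, h1, Part.mem_bind_iff.2 ⟨_, h2, h3⟩⟩)
  obtain ⟨c2, rfl⟩ := crossMap_extend
    (A := fun x : ℝ × Vec (n + 1) × Vec (n + 1) × Vec (n + 1) => x.2.2.1)
    (B := fun x => x.2.2.2) (C := fun x => x.2.1) (by fun_prop) (by fun_prop) (by fun_prop) h2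
  exact ⟨shift_continuousAt c2 c3, (Part.mem_some_iff.1 ha).symm⟩

end Face

/-- Two steps of the `m`-component quad-equation on adjacent faces of a cube, followed by a third. -/
theorem extendedBy_cube {X : Type} [TopologicalSpace X] (b₁ b₂ c₁ c₂ d₁ d₂ : ℝ)
    {A₁ B₁ A₂ B₂ D E : X → Vec (n + 1)} (hA₁ : Continuous A₁) (hB₁ : Continuous B₁)
    (hA₂ : Continuous A₂) (hB₂ : Continuous B₂) (hD : Continuous D) (hE : Continuous E) :
    ExtendedBy
      (fun x => do
        let S ← crossMap b₁ b₂ (A₁ x, B₁ x, D x)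
        let T ← crossMap c₁ c₂ (A₂ x, B₂ x, D x)
        crossMap d₁ d₂ (S, T, E x))
      (fun x => crossVal d₁ d₂ (crossVal b₁ b₂ (A₁ x, B₁ x, D x),
        crossVal c₁ c₂ (A₂ x, B₂ x, D x), E x)) := by
  intro x a ha
  obtain ⟨S, h1, ha⟩ := Part.mem_bind_iff.1 ha
  obtain ⟨T, h2, ha⟩ := Part.mem_bind_iff.1 ha
  obtain ⟨k1, rfl⟩ := crossMap_extend hA₁.continuousAt hB₁.continuousAt hD.continuousAt h1
  obtain ⟨k2, rfl⟩ := crossMap_extend hA₂.continuousAt hB₂.continuousAt hD.continuousAt h2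
  exact crossMap_extend k1 k2 hE.continuousAt ha

/-! ### Assembly of the consistency statements -/

theorem multidimConsistent {ι : Type*} (β : ι → ℝ) (hβ : ∀ i, β i ≠ 0)
    (hinj : n = 0 → Function.Injective β) :
    MultidimConsistent (m := n + 1) (fun i => quadMap (β i)) (fun i j => crossMap (β i) (β j)) where
  symm i j hij := by
    refine identEq_of_eventually (extendedBy_crossMap (β i) (β j))
      (G := crossVal (β i) (β j)) ?_ ?_
    · rintro ⟨Vi, Vj, V⟩ a ha
      exact extendedBy_crossMap (β i) (β j) (Vi, Vj, V) a (by
        have h : a ∈ crossMap (β j) (β i) (Vj, Vi, V) := ha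
        rwa [← crossMap_symm] at h)
    · filter_upwards [eventually_faceGood_prod (βj := β j) (hβ i)]
      rintro ⟨Vi, Vj, V⟩ h
      exact ⟨_, h.crossVal_mem, by
        rw [← crossMap_symm]
        exact h.crossVal_mem⟩
  face_left i j hij := by
    refine identEq_of_eventually (extendedBy_face (β i) (β j))
      (extendedBy_shift_left (β i) (β j)) ?_
    filter_upwards [eventually_faceGood_prod_real (βj := β j) (hβ i)]
    rintro ⟨vm, V, Vi, Vj⟩ h
    refine ⟨_, Part.mem_bind_iff.2 ⟨_, h.quadVal_left vm, Part.mem_bind_iff.2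
      ⟨_, h.symm.quadVal_left vm, h.shift_mem (hβ i) (hβ j) vm⟩⟩, ?_⟩
    rw [← h.corner_eq (hβ i) (hβ j)]
    refine Part.mem_bind_iff.2 ⟨_, h.symm.quadVal_left vm, Part.mem_bind_iff.2
      ⟨_, h.crossVal_mem, Part.mem_bind_iff.2 ⟨_, ?_, Part.mem_some _⟩⟩⟩
    rw [crossVal_symm]
    exact h.symm.quadVal_cross (hβ i) _
  face_right i j hij := by
    refine identEq_of_eventually (extendedBy_face (β i) (β j))
      (extendedBy_shift_right (β i) (β j)) ?_
    filter_upwards [eventually_faceGood_prod_real (βj := β j) (hβ i)]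
    rintro ⟨vm, V, Vi, Vj⟩ h
    exact ⟨_, Part.mem_bind_iff.2 ⟨_, h.quadVal_left vm, Part.mem_bind_iff.2
      ⟨_, h.symm.quadVal_left vm, h.shift_mem (hβ i) (hβ j) vm⟩⟩,
      Part.mem_bind_iff.2 ⟨_, h.quadVal_left vm, Part.mem_bind_iff.2
      ⟨_, h.crossVal_mem, Part.mem_bind_iff.2 ⟨_, h.quadVal_cross (hβ j) _, Part.mem_some _⟩⟩⟩⟩
  face_corner i j hij := by
    refine identEq_of_eventually (extendedBy_corner_left (β i) (β j))
      (extendedBy_corner_right (β i) (β j)) ?_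
    filter_upwards [eventually_faceGood_prod_real (βj := β j) (hβ i)]
    rintro ⟨vm, V, Vi, Vj⟩ h
    refine ⟨_, ?_, Part.mem_bind_iff.2 ⟨_, h.quadVal_left vm, Part.mem_bind_iff.2
      ⟨_, h.crossVal_mem, h.quadVal_cross (hβ j) _⟩⟩⟩
    rw [← h.corner_eq (hβ i) (hβ j)]
    refine Part.mem_bind_iff.2 ⟨_, h.symm.quadVal_left vm, Part.mem_bind_iff.2
      ⟨_, h.crossVal_mem, ?_⟩⟩
    rw [crossVal_symm]
    exact h.symm.quadVal_cross (hβ i) _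
  cube_left i j k hij hjk hki := by
    refine identEq_of_eventually
      (extendedBy_cube (β i) (β j) (β i) (β k) (β j) (β k)
        (A₁ := fun x : Vec (n + 1) × Vec (n + 1) × Vec (n + 1) × Vec (n + 1) => x.2.1)
        (B₁ := fun x => x.2.2.1) (A₂ := fun x => x.2.1) (B₂ := fun x => x.2.2.2)
        (D := fun x => x.1) (E := fun x => x.2.1) (by fun_prop) (by fun_prop) (by fun_prop)
        (by fun_prop) (by fun_prop) (by fun_prop))
      (extendedBy_cube (β i) (β j) (β j) (β k) (β i) (β k)
        (A₁ := fun x : Vec (n + 1) × Vec (n + 1) × Vec (n + 1) × Vec (n + 1) => x.2.1)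
        (B₁ := fun x => x.2.2.1) (A₂ := fun x => x.2.2.1) (B₂ := fun x => x.2.2.2)
        (D := fun x => x.1) (E := fun x => x.2.2.1) (by fun_prop) (by fun_prop) (by fun_prop)
        (by fun_prop) (by fun_prop) (by fun_prop)) ?_
    filter_upwards [eventually_cubeGood_prod (hβ i) (hβ j) (hβ k)
      fun h0 => (hinj h0).ne hki.symm]
    rintro ⟨V, Vi, Vj, Vk⟩ h
    refine ⟨_, Part.mem_bind_iff.2 ⟨_, h.ij.crossVal_mem, Part.mem_bind_iff.2
      ⟨_, h.ik.crossVal_mem, h.cubeVal_mem (hβ i) (hβ j) (hβ k)⟩⟩,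
      Part.mem_bind_iff.2 ⟨_, h.ij.crossVal_mem, Part.mem_bind_iff.2 ⟨_, h.jk.crossVal_mem, ?_⟩⟩⟩
    have := h.swap_left.cubeVal_mem (hβ j) (hβ i) (hβ k)
    rwa [cubeVal_swap_left, crossVal_symm (β j) (β i)] at this
  cube_right i j k hij hjk hki := by
    refine identEq_of_eventually
      (extendedBy_cube (β i) (β j) (β j) (β k) (β i) (β k)
        (A₁ := fun x : Vec (n + 1) × Vec (n + 1) × Vec (n + 1) × Vec (n + 1) => x.2.1)
        (B₁ := fun x => x.2.2.1) (A₂ := fun x => x.2.2.1) (B₂ := fun x => x.2.2.2)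
        (D := fun x => x.1) (E := fun x => x.2.2.1) (by fun_prop) (by fun_prop) (by fun_prop)
        (by fun_prop) (by fun_prop) (by fun_prop))
      (extendedBy_cube (β i) (β k) (β j) (β k) (β i) (β j)
        (A₁ := fun x : Vec (n + 1) × Vec (n + 1) × Vec (n + 1) × Vec (n + 1) => x.2.1)
        (B₁ := fun x => x.2.2.2) (A₂ := fun x => x.2.2.1) (B₂ := fun x => x.2.2.2)
        (D := fun x => x.1) (E := fun x => x.2.2.2) (by fun_prop) (by fun_prop) (by fun_prop)
        (by fun_prop) (by fun_prop) (by fun_prop)) ?_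
    filter_upwards [eventually_cubeGood_prod (hβ i) (hβ j) (hβ k)
      fun h0 => (hinj h0).ne hki.symm]
    rintro ⟨V, Vi, Vj, Vk⟩ h
    refine ⟨cubeVal (β i) (β j) (β k) V Vi Vj Vk,
      Part.mem_bind_iff.2 ⟨_, h.ij.crossVal_mem, Part.mem_bind_iff.2 ⟨_, h.jk.crossVal_mem, ?_⟩⟩,
      Part.mem_bind_iff.2 ⟨_, h.ik.crossVal_mem, Part.mem_bind_iff.2 ⟨_, h.jk.crossVal_mem, ?_⟩⟩⟩
    · have := h.swap_left.cubeVal_mem (hβ j) (hβ i) (hβ k)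
      rwa [cubeVal_swap_left, crossVal_symm (β j) (β i)] at this
    -- The two exchanges put the directions in the order `k`, `i`, `j`.
    · have := h.swap_right.swap_left.cubeVal_mem (hβ k) (hβ i) (hβ j)
      rwa [cubeVal_swap_left, cubeVal_swap_right, crossVal_symm (β k) (β i),
        crossVal_symm (β k) (β j)] at this

end MultiQuad

theorem theorem1 {ι : Type*} (m : ℕ) [NeZero m] (β : ι → ℝ) (hβ : ∀ i, β i ≠ 0)
    (hinj : m = 1 → Function.Injective β) :
    MultiQuad.MultidimConsistent (m := m)
      (fun i => MultiQuad.quadMap (β i)) (fun i j => MultiQuad.crossMap (β i) (β j)) ∧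
    MultiQuad.LatticeConsistent m β ∧
    (∀ (v : ℤ → ℝ → ℝ) (t : ℝ), MultiQuad.PotentialLatticeAt m v t →
      MultiQuad.BogoyavlenskyAt m (fun n τ => v (n + (m : ℤ)) τ / v n τ) t) := by
  obtain ⟨n, rfl⟩ := Nat.exists_eq_succ_of_ne_zero (NeZero.ne m)
  -- The index `0 : Fin (n + 1)` in the equations depends on the `NeZero` instance, which is
  -- replaced here by the canonical one.
  obtain rfl := Subsingleton.elim ‹NeZero (n + 1)› Nat.instNeZeroSucc
  exact ⟨MultiQuad.multidimConsistent β hβ fun h => hinj (by omega),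
    MultiQuad.latticeConsistent (n + 1) β hβ, fun _ _ h => h.bogoyavlenskyAt⟩
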